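/- Let $q,n\ge 1$ be integers, $\mathbb S^q\subset\mathbb R^{q+1}$ the unit sphere with surface measure $\sigma_q$, uniform distribution $\nu_q$ and area $\omega_q=2\pi^{(q+1)/2}/\Gamma((q+1)/2)$. Let $\psi_1(\theta)=\exp(\kappa(\cos\theta-1))$ with $\kappa>0$ and $\psi_2(\theta)=(1-\rho^2)/(1-2\rho\cos\theta+\rho^2)^{(q+1)/2}$ with $0<\rho<1$. For $\ell=1,2$ and $\mathbf X_1,\dots,\mathbf X_n$ in $\mathbb S^q$ with $\theta_{ij}=\cos^{-1}(\mathbf X_i'\mathbf X_j)$, put $$T_{n,\ell}=\frac2n\sum_{1\le i<j\le n}\big(\psi_\ell(\theta_{ij})-\mathbb E_{\mathcal H_0}[\psi_\ell(\theta_{12})]\big),$$ where $\mathbb E_{\mathcal H_0}$ is the expectation for two independent points with distribution $\nu_q$. Let $P_{k,1}=T_k$ be the Chebyshev polynomials of the first kind and, for $q\ge2$, $P_{k,q}=C_k^{(q-1)/2}$ the Gegenbauer polynomials. Let $c_{k,1}=(1+\delta_{k,0})\pi/2$ and $c_{k,q}=\frac{\omega_q}{\omega_{q-1}}\big(1+\frac{2k}{q-1}\big)^{-2}\frac{2k+q-1}{q-1}C_k^{(q-1)/2}(1)$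 for $q\ge2$. For a function $h$ on $[-1,1]$ its Gegenbauer (Chebyshev, if $q=1$) coefficients are $c_{k,q}^{-1}\int_{-1}^1h(x)P_{k,q}(x)(1-x^2)^{q/2-1}\,dx$, $k\ge0$; $b_{k,q}(\psi)$ are those of $x\mapsto\psi(\cos^{-1}x)$. Let $$\tau_{k,q}=\begin{cases}(1+\delta_{k,0})^2/4,&q=1,\\(1+2k/(q-1))^{-2}\,(q-1)_k/k!,&q\ge2,\end{cases}\qquad \zeta_{k_1,k_2,q}=\begin{cases}(1+\delta_{k_1,0})(1+\delta_{k_2,0})/2,&q=1,\\ \omega_{q-1}(1+2k_1/(q-1))^{-1}(1+2k_2/(q-1))^{-1},&q\ge2,\end{cases}$$ with $(a)_k=a(a+1)\cdots(a+k-1)$, and $$t_{k_1,k_2,k_3;q}=\int_{-1}^1P_{k_1,q}(x)P_{k_2,q}(x)P_{k_3,q}(x)(1-x^2)^{q/2-1}\,dx.$$ Let $\boldsymbol\mu\in\mathbb S^q$, let $g$ be square-integrable on $[-1,1]$ with respect to the weight $(1-x^2)^{q/2-1}$, let $f_1(\mathbf x)=g(\mathbf x'\boldsymbol\mu)$ be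 a probability density with respect to $\sigma_q$, and let $e_{k,q}$ be the Gegenbauer (Chebyshev) coefficients of $g$. If $\mathbf X_1,\dots,\mathbf X_n$ are independent with density $f_1$ (hypothesis $\mathcal H_1$), then $T_{n,\ell}$ is square-integrable, the series below converge absolutely, and $$\mathrm{Var}_{\mathcal H_1}[T_{n,\ell}]=\frac{2(n-1)}n\big(2(n-2)\,\eta_{1,\ell}+\eta_{2,\ell}\big),\qquad \eta_{i,\ell}=\alpha_{i,\ell}-\beta_\ell^2,\quad i=1,2,$$ where $$\alpha_{1,\ell}=\omega_q^2\sum_{k_1,k_2,k_3=0}^\infty\zeta_{k_1,k_2,q}\,b_{k_1,q}(\psi_\ell)\,b_{k_2,q}(\psi_\ell)\,e_{k_1,q}\,e_{k_2,q}\,e_{k_3,q}\,t_{k_1,k_2,k_3;q},$$ $$\alpha_{2,\ell}=\omega_q^2\sum_{k=0}^\infty\tau_{k,q}\,b_{k,q}(\psi_\ell^2)\,e_{k,q}^2,\qquad \beta_\ell=\omega_q^2\sum_{k=0}^\infty\tau_{k,q}\,b_{k,q}(\psi_\ell)\,e_{k,q}^2.$$ Moreover, for $k_3\ge k_2\ge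 k_1\ge0$: if $q\ge2$, then $t_{k_1,k_2,k_3;q}=0$ when $k_1+k_2+k_3$ is odd or $k_3>k_1+k_2$, and otherwise $t_{k_1,k_2,k_3;q}=a_{(k_1+k_2-k_3)/2,\,k_1,\,k_2,\,(q-1)/2}\;c_{k_3,q}$ with $$a_{l,k_1,k_2,\lambda}=\frac{k_1+k_2+\lambda-2l}{l!\,(k_1+k_2+\lambda-l)}\binom{k_1+k_2-2l}{k_2-l}\frac{\Gamma(\lambda+l)\,\mathrm B(\lambda+k_1-l,\lambda+k_2-l)}{\Gamma(\lambda)\,\mathrm B(\lambda+k_1+k_2-l,\lambda)},$$ where $\mathrm B$ is Euler's beta function; if $q=1$, then $t_{k_1,k_2,k_3;1}=\frac{1+\delta_{k_1,0}}2c_{k_3,1}$ when $k_3=k_2\pm k_1$, and $t_{k_1,k_2,k_3;1}=0$ otherwise. -/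

import Mathlib

open MeasureTheory ProbabilityTheory
open scoped ENNReal

noncomputable section

namespace SphereUniformity

/-- The ambient Euclidean space `ℝ^(q+1)`. -/
abbrev Ambient (q : ℕ) : Type := EuclideanSpace ℝ (Fin (q + 1))

/-- The unit sphere `𝕊^q` of `ℝ^(q+1)`. -/
abbrev Sphere (q : ℕ) : Type := Metric.sphere (0 : Ambient q) 1

/-- The inner product `x'y` of two points of the sphere, computed in `ℝ^(q+1)`. -/
def dot {q : ℕ} (x y : Sphere q) : ℝ := inner ℝ (x : Ambient q) (y : Ambient q)

/-- The angle `cos⁻¹(x'y)` between two points of the sphere. -/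
def angle {q : ℕ} (x y : Sphere q) : ℝ := Real.arccos (dot x y)

/-- The (non-normalised) surface measure on `𝕊^q`. -/
def surface (q : ℕ) : Measure (Sphere q) := (volume : Measure (Ambient q)).toSphere

/-- The uniform probability measure on `𝕊^q`. -/
def uniform (q : ℕ) : Measure (Sphere q) := (surface q Set.univ)⁻¹ • surface q

/-- The surface area of `𝕊^q`. -/
def area (q : ℕ) : ℝ := 2 * Real.pi ^ (((q : ℝ) + 1) / 2) / Real.Gamma (((q : ℝ) + 1) / 2)

/-- The Gegenbauer polynomials of parameter `a`, through the three-term recurrence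
`(k+2) C_{k+2} = 2 (k+1+a) x C_{k+1} - (k+2a) C_k`. -/
def gegenbauer (a : ℝ) : ℕ → Polynomial ℝ
  | 0 => 1
  | 1 => Polynomial.C (2 * a) * Polynomial.X
  | (k + 2) =>
      Polynomial.C (2 * ((k : ℝ) + 1 + a) / ((k : ℝ) + 2)) * Polynomial.X * gegenbauer a (k + 1)
        - Polynomial.C (((k : ℝ) + 2 * a) / ((k : ℝ) + 2)) * gegenbauer a k

/-- The orthogonal polynomial of degree `k` attached to `𝕊^q`: Chebyshev `T_k` for `q = 1` and
Gegenbauer `C_k^((q-1)/2)` for `q ≥ 2`. -/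
def basisPoly (q k : ℕ) : Polynomial ℝ :=
  if q = 1 then Polynomial.Chebyshev.T ℝ (k : ℤ) else gegenbauer (((q : ℝ) - 1) / 2) k

/-- The weight `(1 - x²)^(q/2 - 1)`. -/
def weight (q : ℕ) (x : ℝ) : ℝ := (1 - x ^ 2) ^ ((q : ℝ) / 2 - 1)

/-- The weighted Lebesgue measure on `[-1, 1]`. -/
def weightMeasure (q : ℕ) : Measure ℝ :=
  (volume.restrict (Set.Icc (-1 : ℝ) 1)).withDensity (fun x => ENNReal.ofReal (weight q x))

/-- The squared norms `c_{k,q}` of the orthogonal polynomials. -/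
def normConst (q k : ℕ) : ℝ :=
  if q = 1 then (1 + if k = 0 then 1 else 0) * Real.pi / 2
  else area q / area (q - 1) * ((1 + 2 * (k : ℝ) / ((q : ℝ) - 1)) ^ 2)⁻¹ *
    ((2 * (k : ℝ) + (q : ℝ) - 1) / ((q : ℝ) - 1) * (basisPoly q k).eval 1)

/-- The `k`-th Gegenbauer (Chebyshev, if `q = 1`) coefficient of a function on `[-1, 1]`. -/
def coeff (q : ℕ) (h : ℝ → ℝ) (k : ℕ) : ℝ :=
  (normConst q k)⁻¹ * ∫ x in (-1 : ℝ)..1, h x * (basisPoly q k).eval x * weight q x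

/-- The coefficients `b_{k,q}(ψ)` of a kernel `ψ(θ)`, `θ ∈ [0, π]`: those of
`x ↦ ψ(cos⁻¹ x)`. -/
def kernelCoeff (q : ℕ) (ψ : ℝ → ℝ) (k : ℕ) : ℝ := coeff q (fun x => ψ (Real.arccos x)) k

/-- The smooth maximum kernel. -/
def smoothMaxKernel (κ : ℝ) (θ : ℝ) : ℝ := Real.exp (κ * (Real.cos θ - 1))

/-- The Poisson kernel. -/
def poissonKernel (q : ℕ) (ρ : ℝ) (θ : ℝ) : ℝ :=
  (1 - ρ ^ 2) / (1 - 2 * ρ * Real.cos θ + ρ ^ 2) ^ (((q : ℝ) + 1) / 2)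

/-- The two families of kernels. -/
def IsTestKernel (q : ℕ) (ψ : ℝ → ℝ) : Prop :=
  (∃ κ : ℝ, 0 < κ ∧ ψ = smoothMaxKernel κ) ∨ (∃ ρ : ℝ, 0 < ρ ∧ ρ < 1 ∧ ψ = poissonKernel q ρ)

/-- The expectation of `ψ(θ₁₂)` for two independent uniform points of `𝕊^q`. -/
def nullMean (q : ℕ) (ψ : ℝ → ℝ) : ℝ :=
  ∫ p : Sphere q × Sphere q, ψ (angle p.1 p.2) ∂((uniform q).prod (uniform q))

/-- The statistic `T_n` of a sample `x`. -/
def statistic {q n : ℕ} (ψ : ℝ → ℝ) (x : Fin n → Sphere q) : ℝ :=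
  2 / (n : ℝ) * ∑ i : Fin n, ∑ j ∈ Finset.Ioi i, (ψ (angle (x i) (x j)) - nullMean q ψ)

/-- The law on `𝕊^q` with density `x ↦ g(x'μ)` with respect to the surface measure. -/
def rotSymLaw {q : ℕ} (m : Sphere q) (g : ℝ → ℝ) : Measure (Sphere q) :=
  (surface q).withDensity (fun x => ENNReal.ofReal (g (dot x m)))

/-- The constants `τ_{k,q}`. -/
def tau (q k : ℕ) : ℝ :=
  if q = 1 then (1 + if k = 0 then 1 else 0) ^ 2 / 4
  else ((1 + 2 * (k : ℝ) / ((q : ℝ) - 1)) ^ 2)⁻¹ *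
    ((ascPochhammer ℝ k).eval ((q : ℝ) - 1) / (k.factorial : ℝ))

/-- The constants `ζ_{k₁,k₂,q}`. -/
def zeta (q k₁ k₂ : ℕ) : ℝ :=
  if q = 1 then (1 + if k₁ = 0 then 1 else 0) * (1 + if k₂ = 0 then 1 else 0) / 2
  else area (q - 1) * (1 + 2 * (k₁ : ℝ) / ((q : ℝ) - 1))⁻¹ *
    (1 + 2 * (k₂ : ℝ) / ((q : ℝ) - 1))⁻¹

/-- The triple-product integrals `t_{k₁,k₂,k₃;q}`. -/
def triple (q k₁ k₂ k₃ : ℕ) : ℝ :=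
  ∫ x in (-1 : ℝ)..1, (basisPoly q k₁).eval x * (basisPoly q k₂).eval x *
    (basisPoly q k₃).eval x * weight q x

/-- The coefficients of the linearization formula for products of Gegenbauer polynomials of
parameter `a`; `ProbabilityTheory.beta` is Euler's beta function. It is used for
`l ≤ min k₁ k₂` only. -/
def linCoeff (l k₁ k₂ : ℕ) (a : ℝ) : ℝ :=
  ((k₁ : ℝ) + k₂ + a - 2 * l) / ((l.factorial : ℝ) * ((k₁ : ℝ) + k₂ + a - l)) *
    (Nat.choose (k₁ + k₂ - 2 * l) (k₂ - l) : ℝ) *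
    (Real.Gamma (a + l) * ProbabilityTheory.beta (a + k₁ - l) (a + k₂ - l) /
      (Real.Gamma a * ProbabilityTheory.beta (a + k₁ + k₂ - l) a))

/-- The terms of the series for `α₁`. -/
def alphaOneTerm (q : ℕ) (ψ g : ℝ → ℝ) (k : ℕ × ℕ × ℕ) : ℝ :=
  zeta q k.1 k.2.1 * kernelCoeff q ψ k.1 * kernelCoeff q ψ k.2.1 *
    coeff q g k.1 * coeff q g k.2.1 * coeff q g k.2.2 * triple q k.1 k.2.1 k.2.2

/-- The terms of the series for `β`; at `ψ²` in place of `ψ`, those of the series for `α₂`. -/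
def betaTerm (q : ℕ) (ψ g : ℝ → ℝ) (k : ℕ) : ℝ :=
  tau q k * kernelCoeff q ψ k * coeff q g k ^ 2

/-- `α₁`. -/
def alphaOne (q : ℕ) (ψ g : ℝ → ℝ) : ℝ := area q ^ 2 * ∑' k, alphaOneTerm q ψ g k

/-- `α₂`. -/
def alphaTwo (q : ℕ) (ψ g : ℝ → ℝ) : ℝ := area q ^ 2 * ∑' k, betaTerm q (fun θ => ψ θ ^ 2) g k

/-- `β`. -/
def betaConst (q : ℕ) (ψ g : ℝ → ℝ) : ℝ := area q ^ 2 * ∑' k, betaTerm q ψ g k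

/-- `η₁ = α₁ - β²`. -/
def etaOne (q : ℕ) (ψ g : ℝ → ℝ) : ℝ := alphaOne q ψ g - betaConst q ψ g ^ 2

/-- `η₂ = α₂ - β²`. -/
def etaTwo (q : ℕ) (ψ g : ℝ → ℝ) : ℝ := alphaTwo q ψ g - betaConst q ψ g ^ 2

end SphereUniformity

end

/-
The kernel `x ↦ ψ (arccos x)` extends analytically to a disc of radius larger than `1`, so its
Gegenbauer coefficients decay geometrically and its Gegenbauer series converges uniformly on
`[-1, 1]`. By the Funk–Hecke formula, integrating that series in one variable against the law `ν`
of the sample multiplies the `k`-th coefficient by a multiple of `e_{k,q}`; hence the projection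
`x ↦ ∫ ψ (angle x y) dν(y)` is again a series in the `P_{k,q} (x'μ)`. Integrating the projection
against `ν` gives the series for `β` and, with `ψ²` for `ψ`, the one for `α₂`. The square of the
projection is a double series in products of two Gegenbauer polynomials, whose integrals against
`ν` expand in the triple products `t_{k₁,k₂,k₃;q}`; this is the series for `α₁`. Thus `η₁` is the
variance of the projection and `η₂` that of the kernel, and the variance of the U-statistic is
obtained by counting the common entries of two pairs of indices. For `q ≥ 2` the triple products
come from the three-term recurrence, which determines them from their values at `k₁ = 0`.
-/

noncomputable section

namespace SphereUniformity

open Polynomial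

section BetaIntegrals

lemma integral_betaPDFReal {α β : ℝ} (hα : 0 < α) (hβ : 0 < β) :
    ∫ x in Set.Ioi 0, betaPDFReal α β x = 1 := by
  have hzero : ∀ x ∉ Set.Ioi 0, betaPDFReal α β x = 0 := fun x hx => if_neg fun h => hx h.1
  have hnonneg : ∀ x, 0 ≤ betaPDFReal α β x := fun x => by
    by_cases hx : 0 < x ∧ x < 1
    · exact (betaPDFReal_pos hx.1 hx.2 hα hβ).le
    · simp [betaPDFReal, hx]
  have hlint := lintegral_betaPDF_eq_one hα hβ
  simp only [betaPDF] at hlint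
  rw [setIntegral_eq_integral_of_forall_compl_eq_zero hzero,
    integral_eq_lintegral_of_nonneg_ae (.of_forall hnonneg) (by fun_prop), hlint,
    ENNReal.toReal_one]

lemma integral_Ioo_rpow_mul_one_sub_sq_rpow {α β : ℝ} (hα : 0 < α) (hβ : 0 < β) :
    ∫ x in Set.Ioo (0 : ℝ) 1, x ^ (2 * α - 1) * (1 - x ^ 2) ^ (β - 1) = beta α β / 2 := by
  have hB := beta_pos hα hβ
  have hpdf : ∀ x ∈ Set.Ioi (0 : ℝ), (2 * x ^ ((2 : ℝ) - 1)) • betaPDFReal α β (x ^ (2 : ℝ)) =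
      (Set.Iio 1).indicator
        (fun x => 2 / beta α β * (x ^ (2 * α - 1) * (1 - x ^ 2) ^ (β - 1))) x := by
    intro x (hx : 0 < x)
    have hsq : 0 < x ^ 2 ∧ x ^ 2 < 1 ↔ x ∈ Set.Iio 1 := by simp [sq_lt_one_iff₀ hx.le, hx]
    simp only [Real.rpow_two, betaPDFReal, hsq, Set.indicator_apply]
    split_ifs
    · rw [← Real.rpow_two, ← Real.rpow_mul hx.le,
        show 2 * α - 1 = (2 - 1) + 2 * (α - 1) by ring, Real.rpow_add hx, smul_eq_mul]
      ring
    · exact smul_zero _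
  have hsubst := integral_comp_rpow_Ioi_of_pos (g := betaPDFReal α β) two_pos
  rw [integral_betaPDFReal hα hβ, setIntegral_congr_fun measurableSet_Ioi hpdf,
    setIntegral_indicator measurableSet_Iio, Set.Ioi_inter_Iio, integral_const_mul] at hsubst
  field_simp at hsubst ⊢
  linarith

lemma integral_pow_mul_one_sub_sq_rpow_of_even {a : ℕ} (ha : Even a) {β : ℝ} (hβ : 0 < β) :
    ∫ x in (-1 : ℝ)..1, x ^ a * (1 - x ^ 2) ^ (β - 1) = beta (((a : ℝ) + 1) / 2) β := by
  set f : ℝ → ℝ := (Set.Iio 1).indicator fun x => x ^ a * (1 - x ^ 2) ^ (β - 1) with hf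
  have habs : (Set.Ioo (-1 : ℝ) 1).indicator (fun x => x ^ a * (1 - x ^ 2) ^ (β - 1)) =
      fun x => f |x| := by
    funext x
    simp only [hf, Set.indicator_apply, Set.mem_Iio, Set.mem_Ioo, abs_lt, sq_abs, ha.pow_abs]
  rw [intervalIntegral.integral_of_le (by norm_num), integral_Ioc_eq_integral_Ioo,
    ← integral_indicator measurableSet_Ioo, habs, integral_comp_abs, hf,
    setIntegral_indicator measurableSet_Iio, Set.Ioi_inter_Iio]
  have hint := integral_Ioo_rpow_mul_one_sub_sq_rpow (α := ((a : ℝ) + 1) / 2) (by positivity) hβ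
  simp only [mul_div_cancel₀ _ (two_ne_zero (α := ℝ)), add_sub_cancel_right,
    Real.rpow_natCast] at hint
  rw [hint, mul_div_cancel₀ _ two_ne_zero]

lemma integral_pow_mul_one_sub_sq_rpow_of_odd {a : ℕ} (ha : Odd a) (r : ℝ) :
    ∫ x in (-1 : ℝ)..1, x ^ a * (1 - x ^ 2) ^ r = 0 := by
  have hneg := intervalIntegral.integral_comp_neg (a := -1) (b := 1)
    fun x : ℝ => x ^ a * (1 - x ^ 2) ^ r
  simp only [ha.neg_pow, neg_sq, neg_mul, intervalIntegral.integral_neg, neg_neg] at hneg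
  linarith

lemma integral_pow_mul_exp_neg_sq_of_even {a : ℕ} (ha : Even a) :
    ∫ t : ℝ, t ^ a * Real.exp (-t ^ 2) = Real.Gamma (((a : ℝ) + 1) / 2) := by
  have habs := integral_comp_abs (f := fun t : ℝ => t ^ a * Real.exp (-t ^ 2))
  have hGamma := integral_rpow_mul_exp_neg_rpow (p := 2) (q := a) two_pos
    (by linarith [a.cast_nonneg (α := ℝ)])
  simp only [sq_abs, ha.pow_abs] at habs
  simp only [Real.rpow_natCast, Real.rpow_ofNat] at hGamma
  rw [habs, hGamma]
  ring

lemma integral_pow_mul_exp_neg_sq_of_odd {a : ℕ} (ha : Odd a) :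
    ∫ t : ℝ, t ^ a * Real.exp (-t ^ 2) = 0 := by
  have hneg := integral_neg_eq_self (fun t : ℝ => t ^ a * Real.exp (-t ^ 2)) volume
  simp only [ha.neg_pow, even_two.neg_pow, neg_mul, integral_neg] at hneg
  linarith

end BetaIntegrals

section Weight

variable (q : ℕ)

lemma weight_nonneg {x : ℝ} (hx : x ∈ Set.Icc (-1 : ℝ) 1) : 0 ≤ weight q x :=
  Real.rpow_nonneg (by nlinarith [hx.1, hx.2]) _

@[fun_prop]
lemma measurable_weight : Measurable (weight q) := by
  unfold weight
  fun_prop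

lemma integral_weightMeasure (f : ℝ → ℝ) :
    ∫ x, f x ∂weightMeasure q = ∫ x in (-1 : ℝ)..1, f x * weight q x := by
  rw [weightMeasure, integral_withDensity_eq_integral_toReal_smul (by fun_prop) (by simp),
    intervalIntegral.integral_of_le (by norm_num), ← integral_Icc_eq_integral_Ioc]
  refine setIntegral_congr_fun measurableSet_Icc fun x hx => ?_
  simp only [ENNReal.toReal_ofReal (weight_nonneg q hx), smul_eq_mul, mul_comm]

lemma ae_mem_Icc_weightMeasure : ∀ᵐ x ∂weightMeasure q, x ∈ Set.Icc (-1 : ℝ) 1 :=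
  (withDensity_absolutelyContinuous _ _).ae_le (ae_restrict_mem measurableSet_Icc)

lemma integral_weightMeasure_pow_mul_one_sub_sq_pow (a b : ℕ) :
    ∫ x, x ^ a * (1 - x ^ 2) ^ b ∂weightMeasure q =
      ∫ x in (-1 : ℝ)..1, x ^ a * (1 - x ^ 2) ^ (b + (q : ℝ) / 2 - 1) := by
  rw [integral_weightMeasure, intervalIntegral.integral_of_le (by norm_num),
    intervalIntegral.integral_of_le (by norm_num), integral_Ioc_eq_integral_Ioo,
    integral_Ioc_eq_integral_Ioo]
  refine setIntegral_congr_fun measurableSet_Ioo fun x hx => ?_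
  have hpos : 0 < 1 - x ^ 2 := by nlinarith [hx.1, hx.2]
  simp only [weight]
  rw [mul_assoc, ← Real.rpow_natCast _ b, ← Real.rpow_add hpos, add_sub_assoc]

variable [NeZero q]

lemma one_le_cast_of_neZero : (1 : ℝ) ≤ q := by exact_mod_cast NeZero.one_le (n := q)

instance isFiniteMeasure_weightMeasure : IsFiniteMeasure (weightMeasure q) := by
  have hq := one_le_cast_of_neZero q
  have hint : Integrable (fun _ : ℝ => (1 : ℝ)) (weightMeasure q) := by
    by_contra hundef
    have hmass := integral_weightMeasure_pow_mul_one_sub_sq_pow q 0 0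
    rw [integral_pow_mul_one_sub_sq_rpow_of_even Even.zero (by positivity)] at hmass
    simp only [pow_zero, mul_one, integral_undef hundef] at hmass
    exact (beta_pos (by positivity) (by positivity)).ne hmass
  exact (integrable_const_iff.1 hint).resolve_left one_ne_zero

lemma integrable_weightMeasure_of_continuousOn {f : ℝ → ℝ} (hf : ContinuousOn f (Set.Icc (-1) 1)) :
    Integrable f (weightMeasure q) := by
  obtain ⟨C, hC⟩ := isCompact_Icc.exists_bound_of_continuousOn hf
  have hac : weightMeasure q ≪ volume.restrict (Set.Icc (-1) 1) :=
    withDensity_absolutelyContinuous _ _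
  refine Integrable.of_bound ((hf.aestronglyMeasurable measurableSet_Icc).mono_ac hac) C ?_
  filter_upwards [ae_mem_Icc_weightMeasure q] with x hx using hC x hx

/-- The linear functional `p ↦ ∫ p(x) (1 - x²)^(q/2 - 1) dx` on polynomials, for which the
`basisPoly q k` are orthogonal. -/
def weightIntegral : ℝ[X] →ₗ[ℝ] ℝ where
  toFun p := ∫ x, p.eval x ∂weightMeasure q
  map_add' p r := by
    simp only [eval_add]
    exact integral_add (integrable_weightMeasure_of_continuousOn q p.continuousOn)
      (integrable_weightMeasure_of_continuousOn q r.continuousOn)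
  map_smul' c p := by simp only [eval_smul, smul_eq_mul, integral_const_mul, RingHom.id_apply]

lemma weightIntegral_apply (p : ℝ[X]) : weightIntegral q p = ∫ x, p.eval x ∂weightMeasure q := rfl

lemma weightIntegral_X_pow_mul_of_even {a : ℕ} (ha : Even a) (b : ℕ) :
    weightIntegral q (X ^ a * (1 - X ^ 2) ^ b) = beta (((a : ℝ) + 1) / 2) (b + (q : ℝ) / 2) := by
  have hq := one_le_cast_of_neZero q
  rw [← integral_pow_mul_one_sub_sq_rpow_of_even ha (by positivity),
    ← integral_weightMeasure_pow_mul_one_sub_sq_pow, weightIntegral_apply]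
  simp only [eval_mul, eval_pow, eval_X, eval_sub, eval_one]

lemma weightIntegral_X_pow_mul_of_odd {a : ℕ} (ha : Odd a) (b : ℕ) :
    weightIntegral q (X ^ a * (1 - X ^ 2) ^ b) = 0 := by
  rw [← integral_pow_mul_one_sub_sq_rpow_of_odd ha (b + (q : ℝ) / 2 - 1),
    ← integral_weightMeasure_pow_mul_one_sub_sq_pow, weightIntegral_apply]
  simp only [eval_mul, eval_pow, eval_X, eval_sub, eval_one]

lemma weightIntegral_one_sub_X_sq_mul_derivative_X_pow (n : ℕ) :
    weightIntegral q ((1 - X ^ 2) * derivative (X ^ n)) = q * weightIntegral q (X * X ^ n) := by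
  have hq := one_le_cast_of_neZero q
  have hX : (X : ℝ[X]) * X ^ n = X ^ (n + 1) * (1 - X ^ 2) ^ 0 := by ring
  rw [hX]
  cases n with
  | zero =>
    rw [zero_add, weightIntegral_X_pow_mul_of_odd q odd_one, pow_zero, derivative_one, mul_zero,
      map_zero, mul_zero]
  | succ c =>
    have hderiv : (1 - X ^ 2) * derivative (X ^ (c + 1)) =
        ((c : ℝ) + 1) • (X ^ c * (1 - X ^ 2) ^ 1 : ℝ[X]) := by
      rw [derivative_X_pow, smul_eq_C_mul]
      push_cast
      simp only [map_add, map_natCast, map_one]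
      ring
    rw [hderiv, map_smul, smul_eq_mul]
    rcases c.even_or_odd with hc | hc
    · rw [weightIntegral_X_pow_mul_of_even q hc,
        weightIntegral_X_pow_mul_of_even q hc.add_one.add_one]
      have hleft : ((c + 1 + 1 : ℕ) + 1 : ℝ) / 2 = ((c : ℝ) + 1) / 2 + 1 := by push_cast; ring
      rw [hleft]
      simp only [beta, Nat.cast_one, Nat.cast_zero, zero_add, add_comm (1 : ℝ) ((q : ℝ) / 2)]
      rw [Real.Gamma_add_one (by positivity), Real.Gamma_add_one (by positivity),
        show ((c : ℝ) + 1) / 2 + (q / 2 + 1) = ((c : ℝ) + 1) / 2 + 1 + q / 2 by ring]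
      ring
    · rw [weightIntegral_X_pow_mul_of_odd q hc,
        weightIntegral_X_pow_mul_of_odd q hc.add_one.add_one, mul_zero, mul_zero]

/-- Pearson's equation for the weight, in the form of an integration by parts. -/
lemma weightIntegral_one_sub_X_sq_mul_derivative (p : ℝ[X]) :
    weightIntegral q ((1 - X ^ 2) * derivative p) = q * weightIntegral q (X * p) := by
  induction p using Polynomial.induction_on' with
  | add p r hp hr => simp only [map_add, mul_add, hp, hr]
  | monomial n c =>
    rw [← C_mul_X_pow_eq_monomial, ← smul_eq_C_mul, derivative_smul, mul_smul_comm, map_smul,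
      weightIntegral_one_sub_X_sq_mul_derivative_X_pow, mul_smul_comm, map_smul]
    simp only [smul_eq_mul, mul_left_comm]

end Weight

section PolarCoordinates

lemma integral_volumeIoiPow_pow_mul_exp_neg_sq (n d : ℕ) :
    ∫ r : Set.Ioi (0 : ℝ), (r : ℝ) ^ d * Real.exp (-(r : ℝ) ^ 2) ∂(.volumeIoiPow n) =
      Real.Gamma (((d : ℝ) + n + 1) / 2) / 2 := by
  have hrpow : ∀ x ∈ Set.Ioi (0 : ℝ), Real.toNNReal (x ^ n) • (x ^ d * Real.exp (-x ^ 2)) =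
      x ^ ((d : ℝ) + n) * Real.exp (-x ^ (2 : ℝ)) := by
    intro x (hx : 0 < x)
    rw [NNReal.smul_def, Real.coe_toNNReal _ (pow_nonneg hx.le _), smul_eq_mul, Real.rpow_add hx,
      Real.rpow_natCast, Real.rpow_natCast, Real.rpow_two]
    ring
  simp only [Measure.volumeIoiPow, ENNReal.ofReal]
  rw [integral_withDensity_eq_integral_smul (measurable_subtype_coe.pow_const _).real_toNNReal,
    integral_subtype_comap measurableSet_Ioi
      fun x : ℝ => Real.toNNReal (x ^ n) • (x ^ d * Real.exp (-x ^ 2)),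
    setIntegral_congr_fun measurableSet_Ioi hrpow,
    integral_rpow_mul_exp_neg_rpow two_pos (neg_one_lt_zero.trans_le (by positivity))]
  ring

lemma integral_homogeneous_mul_exp_neg_norm_sq {E : Type*} [NormedAddCommGroup E] [NormedSpace ℝ E]
    [FiniteDimensional ℝ E] [Nontrivial E] [MeasurableSpace E] [BorelSpace E] (μ : Measure E)
    [μ.IsAddHaarMeasure] {d : ℕ} {h : E → ℝ}
    (hh : ∀ (r : ℝ) (z : E), 0 < r → h (r • z) = r ^ d * h z) :
    ∫ z, h z * Real.exp (-‖z‖ ^ 2) ∂μ = (∫ y : Metric.sphere (0 : E) 1, h y ∂μ.toSphere) *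
      (Real.Gamma (((d : ℝ) + Module.finrank ℝ E) / 2) / 2) := by
  let F : Metric.sphere (0 : E) 1 × Set.Ioi (0 : ℝ) → ℝ :=
    fun p => h p.1 * ((p.2 : ℝ) ^ d * Real.exp (-(p.2 : ℝ) ^ 2))
  have hpolar : ∀ z : ({0}ᶜ : Set E),
      h z * Real.exp (-‖(z : E)‖ ^ 2) = F (homeomorphUnitSphereProd E z) := by
    intro z
    have hz : 0 < ‖(z : E)‖ := norm_pos_iff.2 z.2
    simp only [F, homeomorphUnitSphereProd_apply_snd_coe, homeomorphUnitSphereProd_apply_fst_coe,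
      hh _ _ (inv_pos.2 hz), inv_pow]
    field_simp
  calc
    ∫ z, h z * Real.exp (-‖z‖ ^ 2) ∂μ
      = ∫ z : ({0}ᶜ : Set E), h z * Real.exp (-‖(z : E)‖ ^ 2) ∂(μ.comap (↑)) := by
        rw [integral_subtype_comap (measurableSet_singleton _).compl
          fun z : E => h z * Real.exp (-‖z‖ ^ 2), restrict_compl_singleton]
    _ = ∫ p, F p ∂(μ.toSphere.prod (.volumeIoiPow (Module.finrank ℝ E - 1))) := by
        simp only [hpolar]
        exact μ.measurePreserving_homeomorphUnitSphereProd.integral_comp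
          (Homeomorph.measurableEmbedding _) F
    _ = (∫ y : Metric.sphere (0 : E) 1, h y ∂μ.toSphere) * ∫ r : Set.Ioi (0 : ℝ),
          (r : ℝ) ^ d * Real.exp (-(r : ℝ) ^ 2) ∂(.volumeIoiPow (Module.finrank ℝ E - 1)) :=
        integral_prod_mul (fun y : Metric.sphere (0 : E) 1 => h y)
          fun r : Set.Ioi (0 : ℝ) => (r : ℝ) ^ d * Real.exp (-(r : ℝ) ^ 2)
    _ = _ := by
        rw [integral_volumeIoiPow_pow_mul_exp_neg_sq, add_assoc,
          Nat.cast_pred Module.finrank_pos, sub_add_cancel]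

lemma integral_prod_inner_mul_exp_neg_norm_sq {E ι : Type*} [NormedAddCommGroup E]
    [InnerProductSpace ℝ E] [FiniteDimensional ℝ E] [MeasurableSpace E] [BorelSpace E] [Fintype ι]
    (b : OrthonormalBasis ι ℝ E) (f : ι → ℝ → ℝ) :
    ∫ z, (∏ i, f i (inner ℝ (b i) z)) * Real.exp (-‖z‖ ^ 2) =
      ∏ i, ∫ t, f i t * Real.exp (-t ^ 2) := by
  let F : EuclideanSpace ℝ ι → ℝ := fun w => (∏ i, f i (w i)) * Real.exp (-‖w‖ ^ 2)
  calc
    ∫ z, (∏ i, f i (inner ℝ (b i) z)) * Real.exp (-‖z‖ ^ 2) = ∫ z, F (b.repr z) := by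
        simp only [F, b.repr_apply_apply, LinearIsometryEquiv.norm_map]
    _ = ∫ w, F w := b.measurePreserving_repr.integral_comp
        b.repr.toHomeomorph.measurableEmbedding F
    _ = ∫ w, F (WithLp.toLp 2 w) := ((PiLp.volume_preserving_toLp ι).integral_comp
        (MeasurableEquiv.toLp 2 (ι → ℝ)).measurableEmbedding F).symm
    _ = ∫ w : ι → ℝ, ∏ i, f i (w i) * Real.exp (-w i ^ 2) := by
        simp only [F, EuclideanSpace.norm_sq_eq, Real.norm_eq_abs, sq_abs, Finset.prod_mul_distrib,
          ← Real.exp_sum, Finset.sum_neg_distrib]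
    _ = ∏ i, ∫ t, f i t * Real.exp (-t ^ 2) :=
        integral_fintype_prod_volume_eq_prod fun i t => f i t * Real.exp (-t ^ 2)

end PolarCoordinates

section SphereMoments

instance isFiniteMeasure_surface (q : ℕ) : IsFiniteMeasure (surface q) := by
  unfold surface
  infer_instance

lemma area_pos (q : ℕ) : 0 < area q := by
  unfold area
  positivity

lemma dot_comm {q : ℕ} (x y : Sphere q) : dot x y = dot y x := real_inner_comm _ _

@[simp]
lemma dot_self {q : ℕ} (x : Sphere q) : dot x x = 1 := by simp [dot]

lemma exists_orthonormalBasis_of_dot_eq_zero {q : ℕ} {x v : Sphere (q + 1)} (hxv : dot x v = 0) :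
    ∃ b : OrthonormalBasis (Fin (q + 2)) ℝ (Ambient (q + 1)), b 0 = x ∧ b 1 = v := by
  have hvx : dot v x = 0 := by rwa [dot_comm]
  let w : Fin (q + 2) → Ambient (q + 1) := fun i => if i = 0 then x else v
  have hw : Orthonormal ℝ (({0, 1} : Set (Fin (q + 2))).domRestrict w) := by
    rw [dot] at hxv hvx
    rw [orthonormal_iff_ite]
    rintro ⟨i, rfl | rfl⟩ ⟨j, rfl | rfl⟩ <;> simp [w, Set.domRestrict, Subtype.ext_iff, hxv, hvx]
  obtain ⟨b, hb⟩ := hw.exists_orthonormalBasis_extension_of_card_eq (by simp)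
  exact ⟨b, by simpa [w] using hb 0 (by simp), by simpa [w] using hb 1 (by simp)⟩

lemma integral_surface_dot_pow_mul_dot_pow {q : ℕ} {x v : Sphere (q + 1)} (hxv : dot x v = 0)
    (a b : ℕ) :
    (∫ y, dot x y ^ a * dot v y ^ b ∂(surface (q + 1))) *
        (Real.Gamma (((a : ℝ) + b + q + 2) / 2) / 2) =
      (∫ t : ℝ, t ^ a * Real.exp (-t ^ 2)) * (∫ t : ℝ, t ^ b * Real.exp (-t ^ 2)) *
        √Real.pi ^ q := by
  obtain ⟨B, hB₀, hB₁⟩ := exists_orthonormalBasis_of_dot_eq_zero hxv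
  let f : Fin (q + 2) → ℝ → ℝ :=
    Fin.cons (fun t => t ^ a) (Fin.cons (fun t => t ^ b) fun _ _ => 1)
  have hprod := integral_prod_inner_mul_exp_neg_norm_sq B f
  have hgauss : ∫ t : ℝ, Real.exp (-t ^ 2) = √Real.pi := by
    simpa using integral_gaussian 1
  simp only [Fin.prod_univ_succ, f, Fin.cons_zero, Fin.cons_succ, Fin.succ_zero_eq_one, hB₀, hB₁,
    one_mul, Finset.prod_const_one, mul_one, Finset.prod_const, Finset.card_univ, Fintype.card_fin,
    hgauss, ← mul_assoc] at hprod
  rw [← hprod, integral_homogeneous_mul_exp_neg_norm_sq (d := a + b) volume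
    (h := fun z => inner ℝ (x : Ambient (q + 1)) z ^ a * inner ℝ (v : Ambient (q + 1)) z ^ b)]
  · rw [finrank_euclideanSpace_fin]
    push_cast
    rw [show (a : ℝ) + b + (q + 1 + 1) = a + b + q + 2 by ring]
    rfl
  · intro r z _
    simp only [inner_smul_right]
    ring

/-- The `2j`-th moment of a coordinate of a uniform point of `𝕊^(q-1)`, for `q ≥ 1`. -/
def coordMoment (q j : ℕ) : ℝ :=
  Real.Gamma ((j : ℝ) + 1 / 2) * Real.Gamma ((q : ℝ) / 2) /
    (Real.Gamma (1 / 2) * Real.Gamma ((j : ℝ) + (q : ℝ) / 2))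

@[simp]
lemma coordMoment_zero (q : ℕ) [NeZero q] : coordMoment q 0 = 1 := by
  have hq := one_le_cast_of_neZero q
  have hΓ : Real.Gamma ((q : ℝ) / 2) ≠ 0 := (Real.Gamma_pos_of_pos (by positivity)).ne'
  simp only [coordMoment, Nat.cast_zero, zero_add, Real.Gamma_one_half_eq]
  field_simp

lemma area_mul_coordMoment (q j : ℕ) :
    area q * coordMoment (q + 1) j =
      2 * √Real.pi ^ q * Real.Gamma ((j : ℝ) + 1 / 2) /
        Real.Gamma ((j : ℝ) + ((q : ℝ) + 1) / 2) := by
  have hpow : Real.pi ^ (((q : ℝ) + 1) / 2) = √Real.pi ^ q * √Real.pi := by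
    rw [← pow_succ, Real.sqrt_eq_rpow, ← Real.rpow_natCast, ← Real.rpow_mul Real.pi_pos.le]
    push_cast
    ring_nf
  have hΓ : Real.Gamma (((q : ℝ) + 1) / 2) ≠ 0 := (Real.Gamma_pos_of_pos (by positivity)).ne'
  simp only [area, coordMoment, Nat.cast_add, Nat.cast_one, Real.Gamma_one_half_eq, hpow]
  field_simp

variable {q : ℕ} [NeZero q] {x v : Sphere q}

lemma integral_surface_dot_pow_mul_dot_pow_of_odd (hxv : dot x v = 0) (a : ℕ) {b : ℕ}
    (hb : Odd b) : ∫ y, dot x y ^ a * dot v y ^ b ∂(surface q) = 0 := by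
  obtain ⟨r, rfl⟩ := Nat.exists_eq_succ_of_ne_zero (NeZero.ne q)
  have hmoment := integral_surface_dot_pow_mul_dot_pow hxv a b
  rw [integral_pow_mul_exp_neg_sq_of_odd hb, mul_zero, zero_mul] at hmoment
  exact (mul_eq_zero.1 hmoment).resolve_right (by positivity)

lemma integral_surface_dot_pow_mul_dot_pow_two_mul (hxv : dot x v = 0) (a j : ℕ) :
    ∫ y, dot x y ^ a * dot v y ^ (2 * j) ∂(surface q) =
      area (q - 1) * coordMoment q j * weightIntegral q (X ^ a * (1 - X ^ 2) ^ j) := by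
  obtain ⟨r, rfl⟩ := Nat.exists_eq_succ_of_ne_zero (NeZero.ne q)
  have hmoment := integral_surface_dot_pow_mul_dot_pow hxv a (2 * j)
  have hΓ : 0 < Real.Gamma (((a : ℝ) + (2 * j : ℕ) + r + 2) / 2) :=
    Real.Gamma_pos_of_pos (by positivity)
  rcases a.even_or_odd with ha | ha
  · have hΓj : Real.Gamma ((j : ℝ) + ((r : ℝ) + 1) / 2) ≠ 0 :=
      (Real.Gamma_pos_of_pos (by positivity)).ne'
    have harg : ((a : ℝ) + (2 * j : ℕ) + r + 2) / 2 = (a + 1) / 2 + (j + (r + 1) / 2) := by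
      push_cast
      ring
    have hargj : ((2 * j : ℕ) + 1 : ℝ) / 2 = j + 1 / 2 := by
      push_cast
      ring
    rw [integral_pow_mul_exp_neg_sq_of_even ha,
      integral_pow_mul_exp_neg_sq_of_even (even_two_mul j), hargj] at hmoment
    rw [harg] at hmoment hΓ
    rw [weightIntegral_X_pow_mul_of_even _ ha, Nat.succ_sub_one, area_mul_coordMoment, beta]
    push_cast
    field_simp at hmoment ⊢
    linear_combination hmoment
  · rw [integral_pow_mul_exp_neg_sq_of_odd ha, zero_mul, zero_mul] at hmoment
    rw [weightIntegral_X_pow_mul_of_odd _ ha, mul_zero]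
    exact (mul_eq_zero.1 hmoment).resolve_right (by positivity)

end SphereMoments

section Gegenbauer

/-- The sequence `f` moved one step to the right: its value at `k` is `f (k - 1)`, read as `0` at
`k = 0`. -/
def shiftDown {M : Type*} [Zero M] (f : ℕ → M) : ℕ → M
  | 0 => 0
  | k + 1 => f k

lemma shiftDown_comp {M N : Type*} [Zero M] [Zero N] {φ : M → N} (hφ : φ 0 = 0) (f : ℕ → M)
    (k : ℕ) : shiftDown (fun j => φ (f j)) k = φ (shiftDown f k) := by
  cases k <;> simp [shiftDown, hφ]

variable (a : ℝ)

lemma gegenbauer_add_two (k : ℕ) :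
    C ((k : ℝ) + 2) * gegenbauer a (k + 2) =
      C (2 * ((k : ℝ) + 1 + a)) * X * gegenbauer a (k + 1) -
        C ((k : ℝ) + 2 * a) * gegenbauer a k := by
  have hk : (k : ℝ) + 2 ≠ 0 := by positivity
  rw [gegenbauer, mul_sub, ← mul_assoc, ← mul_assoc, ← mul_assoc, ← C_mul, ← C_mul,
    mul_div_cancel₀ _ hk, mul_div_cancel₀ _ hk]

lemma X_mul_gegenbauer (k : ℕ) :
    C (2 * ((k : ℝ) + a)) * (X * gegenbauer a k) =
      C ((k : ℝ) + 1) * gegenbauer a (k + 1) +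
        C ((k : ℝ) + 2 * a - 1) * shiftDown (gegenbauer a) k := by
  cases k with
  | zero => simp [gegenbauer, shiftDown]
  | succ k =>
    have hrec := gegenbauer_add_two a k
    simp only [shiftDown, Nat.cast_add, Nat.cast_one, C_add, C_sub, C_mul, C_1] at hrec ⊢
    rw [show (C 2 : ℝ[X]) = 2 from rfl] at hrec ⊢
    linear_combination -hrec

lemma one_sub_X_sq_mul_derivative_gegenbauer (k : ℕ) :
    (1 - X ^ 2) * derivative (gegenbauer a k) =
      -C (k : ℝ) * (X * gegenbauer a k) +
        C ((k : ℝ) + 2 * a - 1) * shiftDown (gegenbauer a) k := by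
  induction k using Nat.twoStepInduction with
  | zero => simp [gegenbauer, shiftDown]
  | one =>
    simp only [gegenbauer, shiftDown, derivative_C_mul_X, Nat.cast_one, C_1]
    rw [show (1 : ℝ) + 2 * a - 1 = 2 * a by ring]
    ring
  | more k hk hk_succ =>
    have hrec := gegenbauer_add_two a k
    have hX := X_mul_gegenbauer a k
    have hderiv := congrArg derivative hrec
    have hne : (C ((k : ℝ) + 2) : ℝ[X]) ≠ 0 := C_ne_zero.2 (by positivity)
    refine mul_left_cancel₀ hne ?_
    simp only [derivative_sub, derivative_mul, derivative_C, derivative_X, zero_mul, zero_add,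
      mul_one] at hderiv
    simp only [shiftDown, Nat.cast_add, Nat.cast_one, Nat.cast_ofNat, C_add, C_mul, C_sub, C_1]
      at hrec hX hderiv hk hk_succ ⊢
    rw [show (C 2 : ℝ[X]) = 2 from rfl] at *
    linear_combination (1 - X ^ 2) * hderiv + 2 * (C (k : ℝ) + 1 + C a) * X * hk_succ
      - (C (k : ℝ) + 2 * C a) * hk + (C (k : ℝ) + 2) * X * hrec + (C (k : ℝ) + 2 * C a) * hX

lemma degree_gegenbauer {a : ℝ} (ha : 0 < a) (k : ℕ) : (gegenbauer a k).degree = k := by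
  induction k using Nat.twoStepInduction with
  | zero => simp [gegenbauer]
  | one => rw [gegenbauer, degree_C_mul (by positivity), degree_X, Nat.cast_one]
  | more k hk hk_succ =>
    have hlead : 2 * ((k : ℝ) + 1 + a) / ((k : ℝ) + 2) ≠ 0 := by positivity
    have hdeg : (C (2 * ((k : ℝ) + 1 + a) / ((k : ℝ) + 2)) * X * gegenbauer a (k + 1)).degree =
        ((k + 2 : ℕ) : WithBot ℕ) := by
      rw [degree_mul, degree_C_mul hlead, degree_X, hk_succ]
      norm_cast
      omega
    rw [gegenbauer.eq_3, degree_sub_eq_left_of_degree_lt, hdeg]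
    rw [hdeg]
    rw [← smul_eq_C_mul]
    refine (degree_smul_le _ _).trans_lt ?_
    rw [hk]
    exact_mod_cast (by omega : k < k + 2)

lemma gegenbauer_eval_one (k : ℕ) :
    (gegenbauer a k).eval 1 = (ascPochhammer ℝ k).eval (2 * a) / k.factorial := by
  induction k using Nat.twoStepInduction with
  | zero => simp [gegenbauer]
  | one => simp [gegenbauer]
  | more k hk hk_succ =>
    have hrec := congrArg (eval 1) (gegenbauer_add_two a k)
    have hne : (k : ℝ) + 2 ≠ 0 := by positivity
    simp only [eval_mul, eval_sub, eval_C, eval_X, hk, hk_succ, ascPochhammer_succ_eval,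
      Nat.factorial_succ, mul_one] at hrec ⊢
    rw [← mul_right_inj' hne, hrec]
    push_cast
    rw [show (k : ℝ) + 1 + 1 = k + 2 by ring]
    field_simp
    ring

/-- `(a)_i / i!`, extended by zero to negative `i` so that `pochRatio_succ` holds on all of `ℤ`. -/
def pochRatio (i : ℤ) : ℝ :=
  if i < 0 then 0 else (ascPochhammer ℝ i.toNat).eval a / i.toNat.factorial

lemma pochRatio_natCast (i : ℕ) : pochRatio a i = (ascPochhammer ℝ i).eval a / i.factorial := by
  simp [pochRatio]

lemma pochRatio_of_neg {i : ℤ} (hi : i < 0) : pochRatio a i = 0 := if_pos hi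

lemma pochRatio_succ (i : ℤ) : ((i : ℝ) + 1) * pochRatio a (i + 1) = (a + i) * pochRatio a i := by
  rcases lt_trichotomy i (-1) with hi | rfl | hi
  · rw [pochRatio_of_neg a (by omega), pochRatio_of_neg a (by omega), mul_zero, mul_zero]
  · simp [pochRatio_of_neg a neg_one_lt_zero]
  · lift i to ℕ using by omega
    have hsucc : (i : ℤ) + 1 = (i + 1 : ℕ) := by simp
    rw [hsucc, pochRatio_natCast, pochRatio_natCast, ascPochhammer_succ_eval, Nat.factorial_succ]
    push_cast
    field_simp

/-- `(2a)_s / (a)_{s+1}`, the factor of `tripleValue` that depends on the sum of the degrees. -/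
def pochQuot (s : ℕ) : ℝ := (ascPochhammer ℝ s).eval (2 * a) / (ascPochhammer ℝ (s + 1)).eval a

lemma pochQuot_succ {a : ℝ} (ha : 0 < a) (s : ℕ) :
    (a + s + 1) * pochQuot a (s + 1) = (2 * a + s) * pochQuot a s := by
  have hpos := ascPochhammer_pos (s + 1) a ha
  simp only [pochQuot, ascPochhammer_succ_eval s (2 * a), ascPochhammer_succ_eval (s + 1) a]
  push_cast
  field_simp
  ring

/-- The integral of `C_m C_n C_k` against the normalised weight of parameter `a`; with
`2s = m + n + k` even, it is `a (2a)_s / (a)_{s+1}` times the product of `(a)_i / i!` over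
`i = s - m, s - n, s - k`. -/
def tripleValue (m n k : ℤ) : ℝ :=
  if Even (m + n + k) then
    a * pochQuot a ((m + n + k) / 2).toNat * pochRatio a ((m + n + k) / 2 - m) *
      pochRatio a ((m + n + k) / 2 - n) * pochRatio a ((m + n + k) / 2 - k)
  else 0

lemma tripleValue_of_sum (s m n k : ℤ) (h : m + n + k = 2 * s) :
    tripleValue a m n k =
      a * pochQuot a s.toNat * pochRatio a (s - m) * pochRatio a (s - n) *
        pochRatio a (s - k) := by
  have hs : (m + n + k) / 2 = s := by omega
  rw [tripleValue, if_pos (h ▸ even_two_mul s), hs]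

lemma tripleValue_of_not_even {m n k : ℤ} (h : ¬Even (m + n + k)) : tripleValue a m n k = 0 :=
  if_neg h

lemma tripleValue_comm (m n k : ℤ) : tripleValue a m n k = tripleValue a n m k := by
  simp only [tripleValue, add_comm m n]
  split_ifs <;> ring

lemma tripleValue_right_comm (m n k : ℤ) : tripleValue a m n k = tripleValue a m k n := by
  simp only [tripleValue, add_right_comm m n k]
  split_ifs <;> ring

lemma tripleValue_eq_zero_of_add_lt {m n k : ℤ} (h : m + n < k) : tripleValue a m n k = 0 := by
  by_cases heven : Even (m + n + k)
  · obtain ⟨s, hs⟩ := heven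
    rw [tripleValue_of_sum a s _ _ _ (by omega), pochRatio_of_neg a (show s - k < 0 by omega),
      mul_zero]
  · exact tripleValue_of_not_even a heven

lemma tripleValue_neg_one_left (n k : ℤ) : tripleValue a (-1) n k = 0 := by
  rcases le_or_gt n k with h | h
  · exact tripleValue_eq_zero_of_add_lt a (by omega)
  · rw [tripleValue_right_comm]
    exact tripleValue_eq_zero_of_add_lt a (by omega)

lemma tripleValue_neg_one_right (m n : ℤ) : tripleValue a m n (-1) = 0 := by
  rw [tripleValue_right_comm, tripleValue_comm, tripleValue_neg_one_left]

lemma tripleValue_zero_zero {a : ℝ} (ha : 0 < a) (k : ℕ) :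
    tripleValue a 0 0 k = if k = 0 then 1 else 0 := by
  split_ifs with hk
  · have hzero : pochRatio a 0 = 1 := by simpa using pochRatio_natCast a 0
    simp [hk, tripleValue, hzero, pochQuot, ha.ne']
  · exact tripleValue_eq_zero_of_add_lt a (by omega)

lemma pochQuot_mul_pochRatio_recurrence {a : ℝ} (ha : 0 < a) {A B D : ℤ} {t : ℕ}
    (hsum : (t : ℤ) = A + B + D + 1) :
    ((A : ℝ) + B + 1 + a) *
        (((B : ℝ) + D + 2) *
            (pochQuot a (t + 1) * pochRatio a A * pochRatio a (B + 1) * pochRatio a (D + 1)) +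
          ((B : ℝ) + D + 2 * a) *
            (pochQuot a t * pochRatio a (A + 1) * pochRatio a B * pochRatio a D)) =
      ((B : ℝ) + D + 1 + a) *
        (((A : ℝ) + B + 2) *
            (pochQuot a (t + 1) * pochRatio a (A + 1) * pochRatio a (B + 1) * pochRatio a D) +
          ((A : ℝ) + B + 2 * a) *
            (pochQuot a t * pochRatio a A * pochRatio a B * pochRatio a (D + 1))) := by
  have hQ := pochQuot_succ ha t
  have hA := pochRatio_succ a A
  have hB := pochRatio_succ a B
  have hD := pochRatio_succ a D
  have ht : (t : ℝ) = A + B + D + 1 := by exact_mod_cast hsum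
  have hne : a + t + 1 ≠ 0 := by positivity
  refine mul_left_cancel₀ hne ?_
  rw [ht] at hQ ⊢
  generalize pochQuot a (t + 1) = Q' at *
  generalize pochQuot a t = Q at *
  generalize pochRatio a (A + 1) = x' at *
  generalize pochRatio a A = x at *
  generalize pochRatio a (B + 1) = y' at *
  generalize pochRatio a B = y at *
  generalize pochRatio a (D + 1) = z' at *
  generalize pochRatio a D = z at *
  generalize (A : ℝ) = A at *
  generalize (B : ℝ) = B at *
  generalize (D : ℝ) = D at *
  linear_combination ((A + B + 1 + a) * x * y' * z' * (B + D + 2)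
      - (B + D + 1 + a) * x' * y' * z * (A + B + 2)) * hQ
    + (2 * a + (A + B + D + 1)) * Q * ((A + B + 1 + a) * x * (z' * hB + y' * hD)
      - (B + D + 1 + a) * z * (y' * hA + x' * hB))
    + Q * (((B + D + 2 * a) * (A + 1 + (a + B) + a + (B + D) + 1)
          - (a + B) * (B + D + 1 + a)) * y * z * hA
      - ((A + B + 2 * a) * (D + 1 + (a + B) + a + (A + B) + 1)
          - (a + B) * (A + B + 1 + a)) * x * y * hD
      + (2 * a + (A + B + D + 1)) * (D - A) * x * z * hB)

lemma tripleValue_recurrence {a : ℝ} (ha : 0 < a) (m n k : ℕ) :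
    ((k : ℝ) + a) * (((m : ℝ) + 1) * tripleValue a (m + 1) n k +
        ((m : ℝ) + 2 * a - 1) * tripleValue a (m - 1) n k) =
      ((m : ℝ) + a) * (((k : ℝ) + 1) * tripleValue a m n (k + 1) +
        ((k : ℝ) + 2 * a - 1) * tripleValue a m n (k - 1)) := by
  by_cases heven : Even ((m : ℤ) + n + k + 1)
  · obtain ⟨s, hs⟩ := heven
    obtain ⟨t, rfl⟩ : ∃ t : ℕ, s = t + 1 := ⟨(s - 1).toNat, by omega⟩
    obtain ⟨A, hA⟩ : ∃ A : ℤ, A = t - m := ⟨_, rfl⟩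
    obtain ⟨B, hB⟩ : ∃ B : ℤ, B = t - n := ⟨_, rfl⟩
    obtain ⟨D, hD⟩ : ∃ D : ℤ, D = t - k := ⟨_, rfl⟩
    have hm : (m : ℝ) = B + D + 1 := by exact_mod_cast (by omega : (m : ℤ) = B + D + 1)
    have hk : (k : ℝ) = A + B + 1 := by exact_mod_cast (by omega : (k : ℤ) = A + B + 1)
    rw [tripleValue_of_sum a (t + 1) (m + 1) n k (by omega),
      tripleValue_of_sum a t (m - 1) n k (by omega),
      tripleValue_of_sum a (t + 1) m n (k + 1) (by omega),
      tripleValue_of_sum a t m n (k - 1) (by omega),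
      show (t : ℤ) + 1 - (m + 1) = A by omega, show (t : ℤ) + 1 - n = B + 1 by omega,
      show (t : ℤ) + 1 - k = D + 1 by omega, show (t : ℤ) - (m - 1) = A + 1 by omega,
      show (t : ℤ) - n = B by omega, show (t : ℤ) - k = D by omega,
      show (t : ℤ) + 1 - m = A + 1 by omega, show (t : ℤ) + 1 - (k + 1) = D by omega,
      show (t : ℤ) - m = A by omega, show (t : ℤ) - (k - 1) = D + 1 by omega,
      show ((t : ℤ) + 1).toNat = t + 1 by omega, Int.toNat_natCast, hm, hk]
    linear_combination a * pochQuot_mul_pochRatio_recurrence ha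
      (show (t : ℤ) = A + B + D + 1 by omega)
  · rw [Int.even_iff] at heven
    rw [tripleValue_of_not_even a (by rw [Int.even_iff]; omega),
      tripleValue_of_not_even a (by rw [Int.even_iff]; omega),
      tripleValue_of_not_even a (by rw [Int.even_iff]; omega),
      tripleValue_of_not_even a (by rw [Int.even_iff]; omega)]
    ring

/-- The recurrence in `(m, k)` that expresses multiplication by `X` of `C_m` on the left-hand side
and of `C_k` on the right-hand side in a product `C_m r C_k`, the `C_j` being the Gegenbauer
polynomials of parameter `a`. -/
def IsProductRecurrence (S : ℕ → ℕ → ℝ) : Prop :=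
  ∀ m k : ℕ,
    ((k : ℝ) + a) * (((m : ℝ) + 1) * S (m + 1) k +
        ((m : ℝ) + 2 * a - 1) * shiftDown (fun j => S j k) m) =
      ((m : ℝ) + a) * (((k : ℝ) + 1) * S m (k + 1) +
        ((k : ℝ) + 2 * a - 1) * shiftDown (S m) k)

lemma IsProductRecurrence.const_mul {a : ℝ} {S : ℕ → ℕ → ℝ} (hS : IsProductRecurrence a S)
    (c : ℝ) : IsProductRecurrence a fun m k => c * S m k := by
  intro m k
  rw [shiftDown_comp (mul_zero c) (fun j => S j k) m, shiftDown_comp (mul_zero c) (S m) k]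
  linear_combination c * hS m k

lemma IsProductRecurrence.eq {a : ℝ} (ha : 0 < a) {S T : ℕ → ℕ → ℝ}
    (hS : IsProductRecurrence a S) (hT : IsProductRecurrence a T) (h₀ : S 0 = T 0) : S = T := by
  funext m
  induction m using Nat.strong_induction_on with
  | _ m ih =>
    cases m with
    | zero => exact h₀
    | succ m =>
      funext k
      have hshift : shiftDown (fun j => S j k) m = shiftDown (fun j => T j k) m := by
        cases m with
        | zero => rfl
        | succ m => exact congrFun (ih m (by omega)) k
      have hstep := hS m k
      rw [ih m (by omega), hshift, ← hT m k] at hstep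
      have hk : (k : ℝ) + a ≠ 0 := by positivity
      have hm : (m : ℝ) + 1 ≠ 0 := by positivity
      exact mul_left_cancel₀ hm (add_right_cancel (mul_left_cancel₀ hk hstep))

lemma isProductRecurrence_tripleValue {a : ℝ} (ha : 0 < a) (n : ℕ) :
    IsProductRecurrence a fun m k => tripleValue a m n k := by
  intro m k
  have hm : shiftDown (fun j : ℕ => tripleValue a j n k) m = tripleValue a (m - 1) n k := by
    cases m <;> simp [shiftDown, tripleValue_neg_one_left]
  have hk : shiftDown (fun j : ℕ => tripleValue a m n j) k = tripleValue a m n (k - 1) := by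
    cases k <;> simp [shiftDown, tripleValue_neg_one_right]
  rw [hm, hk]
  exact_mod_cast tripleValue_recurrence ha m n k

lemma isProductRecurrence_map_gegenbauer (V : ℝ[X] →ₗ[ℝ] ℝ) (r : ℝ[X]) :
    IsProductRecurrence a fun m k => V (gegenbauer a m * r * gegenbauer a k) := by
  intro m k
  have hm : V (shiftDown (gegenbauer a) m * r * gegenbauer a k) =
      shiftDown (fun j => V (gegenbauer a j * r * gegenbauer a k)) m :=
    (shiftDown_comp (φ := fun p => V (p * r * gegenbauer a k)) (by simp) _ m).symm
  have hk : V (gegenbauer a m * r * shiftDown (gegenbauer a) k) =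
      shiftDown (fun j => V (gegenbauer a m * r * gegenbauer a j)) k :=
    (shiftDown_comp (φ := fun p => V (gegenbauer a m * r * p)) (by simp) _ k).symm
  rw [← hm, ← hk]
  simp only [← smul_eq_mul (a := (_ : ℝ)), ← map_smul, ← map_add, smul_eq_C_mul]
  have hXm := X_mul_gegenbauer a m
  have hXk := X_mul_gegenbauer a k
  rw [C_mul, show (C 2 : ℝ[X]) = 2 from rfl] at hXm hXk
  congr 1
  linear_combination (-C ((k : ℝ) + a) * r * gegenbauer a k) * hXm
    + (C ((m : ℝ) + a) * r * gegenbauer a m) * hXk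

variable {a} (ha : 0 < a) (V : ℝ[X] →ₗ[ℝ] ℝ)
  (hV : ∀ p, V ((1 - X ^ 2) * derivative p) = (2 * a + 1) * V (X * p))
include ha hV

lemma map_gegenbauer_succ (k : ℕ) : V (gegenbauer a (k + 1)) = 0 := by
  have hstep : ∀ k : ℕ, ((k : ℝ) + 2 * a + 1) * ((k : ℝ) + 1) * V (gegenbauer a (k + 1)) =
      ((k : ℝ) + 2 * a - 1) * ((k : ℝ) - 1) * V (shiftDown (gegenbauer a) k) := by
    intro k
    have hderiv := hV (gegenbauer a k)
    have hX := congrArg V (X_mul_gegenbauer a k)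
    rw [one_sub_X_sq_mul_derivative_gegenbauer, neg_mul] at hderiv
    simp only [← smul_eq_C_mul] at hderiv hX
    simp only [map_add, map_neg, map_smul, smul_eq_mul] at hderiv hX
    linear_combination (-2 * ((k : ℝ) + a)) * hderiv - ((k : ℝ) + 2 * a + 1) * hX
  suffices hright : ((k : ℝ) - 1) * V (shiftDown (gegenbauer a) k) = 0 by
    have hk := hstep k
    rw [mul_assoc _ ((k : ℝ) - 1), hright, mul_zero] at hk
    exact (mul_eq_zero.1 hk).resolve_left (by positivity)
  induction k using Nat.twoStepInduction with
  | zero => simp [shiftDown]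
  | one => simp
  | more k hk _ =>
    have hzero := hstep k
    rw [mul_assoc _ ((k : ℝ) - 1), hk, mul_zero] at hzero
    rw [shiftDown, (mul_eq_zero.1 hzero).resolve_left (by positivity), mul_zero]

theorem map_gegenbauer_mul_gegenbauer_mul_gegenbauer (m n k : ℕ) :
    V (gegenbauer a m * gegenbauer a n * gegenbauer a k) = V 1 * tripleValue a m n k := by
  have hof_zero : ∀ n : ℕ, (∀ k, V (gegenbauer a n * gegenbauer a k) =
      V 1 * tripleValue a 0 n k) → ∀ m k,
      V (gegenbauer a m * gegenbauer a n * gegenbauer a k) = V 1 * tripleValue a m n k := by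
    intro n h₀ m k
    refine congrFun₂ (IsProductRecurrence.eq ha (isProductRecurrence_map_gegenbauer a V _)
      ((isProductRecurrence_tripleValue ha n).const_mul (V 1)) (funext fun k => ?_)) m k
    simpa [gegenbauer] using h₀ k
  have hzero : ∀ m k, V (gegenbauer a m * gegenbauer a 0 * gegenbauer a k) =
      V 1 * tripleValue a m (0 : ℕ) k := by
    refine hof_zero 0 fun k => ?_
    rw [Nat.cast_zero, tripleValue_zero_zero ha]
    cases k with
    | zero => simp [gegenbauer]
    | succ k => simpa [gegenbauer] using map_gegenbauer_succ ha V hV k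
  refine hof_zero n (fun k => ?_) m k
  rw [tripleValue_comm, ← Nat.cast_zero, ← hzero n k, gegenbauer, mul_one]

end Gegenbauer

section BasisPoly

lemma basisPoly_one (k : ℕ) : basisPoly 1 k = Chebyshev.T ℝ k := if_pos rfl

lemma basisPoly_of_ne {q : ℕ} (hq : q ≠ 1) (k : ℕ) :
    basisPoly q k = gegenbauer (((q : ℝ) - 1) / 2) k := if_neg hq

lemma basisPoly_zero (q : ℕ) : basisPoly q 0 = 1 := by
  by_cases hq : q = 1
  · simp [hq, basisPoly_one]
  · simp [basisPoly_of_ne hq, gegenbauer]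

lemma half_pred_pos_of_ne {q : ℕ} [NeZero q] (hq : q ≠ 1) : 0 < ((q : ℝ) - 1) / 2 := by
  have hlt : (1 : ℝ) < q := by exact_mod_cast (NeZero.one_le (n := q)).lt_of_ne' hq
  linarith

lemma degree_basisPoly (q : ℕ) [NeZero q] (k : ℕ) : (basisPoly q k).degree = k := by
  by_cases hq : q = 1
  · simp [hq, basisPoly_one]
  · rw [basisPoly_of_ne hq, degree_gegenbauer (half_pred_pos_of_ne hq)]

lemma natDegree_basisPoly (q : ℕ) [NeZero q] (k : ℕ) : (basisPoly q k).natDegree = k :=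
  natDegree_eq_of_degree_eq_some (degree_basisPoly q k)

lemma mem_span_basisPoly (q : ℕ) [NeZero q] {p : ℝ[X]} {n : ℕ} (hp : p.degree < n) :
    p ∈ Submodule.span ℝ (basisPoly q '' Set.Iio n) := by
  let S : Polynomial.Sequence ℝ := ⟨basisPoly q, degree_basisPoly q⟩
  have hunit : ∀ i < n, IsUnit (S i).leadingCoeff := fun i _ =>
    (leadingCoeff_ne_zero.2 (S.ne_zero i)).isUnit
  change p ∈ Submodule.span ℝ (S '' Set.Iio n)
  rwa [S.span_degreeLT hunit, mem_degreeLT]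

lemma basisPoly_eval_one_of_ne {q : ℕ} (hq : q ≠ 1) (k : ℕ) :
    (basisPoly q k).eval 1 = (ascPochhammer ℝ k).eval ((q : ℝ) - 1) / k.factorial := by
  rw [basisPoly_of_ne hq, gegenbauer_eval_one, mul_div_cancel₀ _ two_ne_zero]

lemma basisPoly_eval_one_pos (q : ℕ) [NeZero q] (k : ℕ) : 0 < (basisPoly q k).eval 1 := by
  by_cases hq : q = 1
  · subst hq
    simp [basisPoly_one]
  · have hpos := ascPochhammer_pos k ((q : ℝ) - 1) (by linarith [half_pred_pos_of_ne hq])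
    rw [basisPoly_eval_one_of_ne hq]
    positivity

lemma basisPoly_eval_one_succ_of_ne {q : ℕ} (hq : q ≠ 1) (k : ℕ) :
    (basisPoly q (k + 1)).eval 1 =
      (basisPoly q k).eval 1 * (((q : ℝ) - 1 + k) / (k + 1)) := by
  rw [basisPoly_eval_one_of_ne hq, basisPoly_eval_one_of_ne hq, ascPochhammer_succ_eval,
    Nat.factorial_succ]
  push_cast
  field_simp

lemma basisPoly_eval_one_le (q : ℕ) [NeZero q] (k : ℕ) :
    (basisPoly q k).eval 1 ≤ ((k : ℝ) + 1) ^ q := by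
  by_cases hq : q = 1
  · simp [hq, basisPoly_one]
  induction k with
  | zero => simp [basisPoly_zero]
  | succ k ih =>
    have hq_pos := half_pred_pos_of_ne hq
    have hratio : ((q : ℝ) - 1 + k) / (k + 1) ≤ (1 + 1 / ((k : ℝ) + 1)) ^ q := by
      refine le_trans ?_ (one_add_mul_le_pow (by
        linarith [show (0 : ℝ) ≤ 1 / ((k : ℝ) + 1) by positivity]) q)
      rw [div_le_iff₀ (by positivity)]
      field_simp
      linarith
    have hnonneg : 0 ≤ ((q : ℝ) - 1 + k) / (k + 1) :=
      div_nonneg (by linarith [k.cast_nonneg (α := ℝ)]) (by positivity)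
    calc (basisPoly q (k + 1)).eval 1
        = (basisPoly q k).eval 1 * (((q : ℝ) - 1 + k) / (k + 1)) :=
          basisPoly_eval_one_succ_of_ne hq k
      _ ≤ ((k : ℝ) + 1) ^ q * (1 + 1 / ((k : ℝ) + 1)) ^ q := by gcongr
      _ = (((k + 1 : ℕ) : ℝ) + 1) ^ q := by
          rw [← mul_pow]
          congr 1
          push_cast
          field_simp

end BasisPoly

section TripleProducts

lemma weightIntegral_one (q : ℕ) [NeZero q] : weightIntegral q 1 = area q / area (q - 1) := by
  have hq := one_le_cast_of_neZero q
  have hbeta := weightIntegral_X_pow_mul_of_even q Even.zero 0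
  have hΓ : Real.Gamma ((q : ℝ) / 2) ≠ 0 := (Real.Gamma_pos_of_pos (by positivity)).ne'
  have hpow : Real.pi ^ (((q : ℝ) + 1) / 2) = Real.pi ^ ((q : ℝ) / 2) * √Real.pi := by
    rw [Real.sqrt_eq_rpow, ← Real.rpow_add Real.pi_pos]
    ring_nf
  simp only [pow_zero, mul_one, Nat.cast_zero, zero_add] at hbeta
  rw [hbeta, beta, Real.Gamma_one_half_eq, area, area, Nat.cast_pred (NeZero.pos q),
    sub_add_cancel, hpow, ← add_div, add_comm (1 : ℝ)]
  field_simp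

lemma weightIntegral_one_pos (q : ℕ) [NeZero q] : 0 < weightIntegral q 1 := by
  rw [weightIntegral_one]
  exact div_pos (area_pos q) (area_pos _)

lemma weightIntegral_one_eq_integral_measureT (p : ℝ[X]) :
    weightIntegral 1 p = ∫ x, p.eval x ∂Chebyshev.measureT := by
  rw [weightIntegral_apply, integral_weightMeasure, Chebyshev.integral_measureT]
  refine intervalIntegral.integral_congr fun x hx => ?_
  rw [Set.uIcc_of_le (by norm_num)] at hx
  have hx' : 0 ≤ 1 - x ^ 2 := by nlinarith [hx.1, hx.2]
  simp only [weight]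
  rw [Real.sqrt_inv, Real.sqrt_eq_rpow, ← Real.rpow_neg hx']
  norm_num

lemma weightIntegral_chebyshev (k : ℤ) :
    weightIntegral 1 (Chebyshev.T ℝ k) = if k = 0 then Real.pi else 0 := by
  rw [weightIntegral_one_eq_integral_measureT]
  split_ifs with hk
  · rw [hk, Chebyshev.integral_eval_T_real_measureT_zero]
  · exact Chebyshev.integral_eval_T_real_measureT_of_ne_zero hk

lemma weightIntegral_chebyshev_mul_mul (k₁ k₂ k₃ : ℤ) :
    weightIntegral 1 (Chebyshev.T ℝ k₁ * Chebyshev.T ℝ k₂ * Chebyshev.T ℝ k₃) =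
      ((if k₁ + k₂ + k₃ = 0 then Real.pi else 0) + (if k₁ + k₂ - k₃ = 0 then Real.pi else 0) +
        (if k₁ - k₂ + k₃ = 0 then Real.pi else 0) +
        (if k₁ - k₂ - k₃ = 0 then Real.pi else 0)) / 4 := by
  have hlin : (4 : ℝ) • (Chebyshev.T ℝ k₁ * Chebyshev.T ℝ k₂ * Chebyshev.T ℝ k₃) =
      Chebyshev.T ℝ (k₁ + k₂ + k₃) + Chebyshev.T ℝ (k₁ + k₂ - k₃) +
        Chebyshev.T ℝ (k₁ - k₂ + k₃) + Chebyshev.T ℝ (k₁ - k₂ - k₃) := by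
    rw [add_assoc, ← Chebyshev.T_mul_T, ← Chebyshev.T_mul_T, smul_eq_C_mul, map_ofNat]
    linear_combination 2 * Chebyshev.T ℝ k₃ * Chebyshev.T_mul_T ℝ k₁ k₂
  have hint := congrArg (weightIntegral 1) hlin
  simp only [map_smul, map_add, weightIntegral_chebyshev, smul_eq_mul] at hint
  linarith

lemma weightIntegral_basisPoly_mul_mul_of_ne {q : ℕ} [NeZero q] (hq : q ≠ 1) (k₁ k₂ k₃ : ℕ) :
    weightIntegral q (basisPoly q k₁ * basisPoly q k₂ * basisPoly q k₃) =
      area q / area (q - 1) * tripleValue (((q : ℝ) - 1) / 2) k₁ k₂ k₃ := by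
  simp only [basisPoly_of_ne hq]
  rw [map_gegenbauer_mul_gegenbauer_mul_gegenbauer (half_pred_pos_of_ne hq) (weightIntegral q),
    weightIntegral_one]
  intro p
  rw [weightIntegral_one_sub_X_sq_mul_derivative]
  ring

lemma normConst_one (k : ℕ) :
    normConst 1 k = (1 + if k = 0 then 1 else 0) * Real.pi / 2 := by simp [normConst]

lemma normConst_of_ne {q : ℕ} [NeZero q] (hq : q ≠ 1) (k : ℕ) :
    normConst q k = area q / area (q - 1) *
      ((((q : ℝ) - 1) / 2) / (k + ((q : ℝ) - 1) / 2) * (basisPoly q k).eval 1) := by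
  have hpos := half_pred_pos_of_ne hq
  have hq_ne : (q : ℝ) - 1 ≠ 0 := by linarith
  have hk_ne : 2 * (k : ℝ) + q - 1 ≠ 0 := by linarith [k.cast_nonneg (α := ℝ)]
  rw [normConst, if_neg hq, show 1 + 2 * (k : ℝ) / ((q : ℝ) - 1) =
      (2 * k + q - 1) / (q - 1) by field_simp; ring,
    show (k : ℝ) + ((q : ℝ) - 1) / 2 = (2 * k + q - 1) / 2 by ring]
  field_simp

lemma normConst_pos (q : ℕ) [NeZero q] (k : ℕ) : 0 < normConst q k := by
  by_cases hq : q = 1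
  · subst hq
    rw [normConst_one]
    have := Real.pi_pos
    positivity
  · have := half_pred_pos_of_ne hq
    have := basisPoly_eval_one_pos q k
    have := area_pos q
    have := area_pos (q - 1)
    rw [normConst_of_ne hq]
    positivity

lemma tripleValue_zero_left_self {a : ℝ} (ha : 0 < a) (k : ℕ) :
    tripleValue a 0 k k = a / (k + a) * ((ascPochhammer ℝ k).eval (2 * a) / k.factorial) := by
  have hpoch := (ascPochhammer_pos k a ha).ne'
  have hzero : pochRatio a 0 = 1 := by simpa using pochRatio_natCast a 0
  rw [tripleValue_of_sum a k _ _ _ (by ring), sub_self, sub_zero, hzero, pochRatio_natCast,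
    Int.toNat_natCast, pochQuot, ascPochhammer_succ_eval, add_comm (k : ℝ)]
  field_simp

theorem weightIntegral_basisPoly_mul (q : ℕ) [NeZero q] (j k : ℕ) :
    weightIntegral q (basisPoly q j * basisPoly q k) = if j = k then normConst q k else 0 := by
  by_cases hq : q = 1
  · subst hq
    have htriple := weightIntegral_chebyshev_mul_mul 0 j k
    rw [Chebyshev.T_zero, one_mul] at htriple
    rw [basisPoly_one, basisPoly_one, htriple, normConst_one]
    split_ifs <;> first | omega | ring
  · have htriple := weightIntegral_basisPoly_mul_mul_of_ne hq 0 j k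
    rw [basisPoly_zero, one_mul, Nat.cast_zero] at htriple
    rw [htriple]
    split_ifs with hjk
    · rw [hjk, tripleValue_zero_left_self (half_pred_pos_of_ne hq), normConst_of_ne hq,
        basisPoly_of_ne hq, gegenbauer_eval_one]
    · rcases Nat.lt_or_gt_of_ne hjk with hlt | hlt
      · rw [tripleValue_eq_zero_of_add_lt _ (by omega), mul_zero]
      · rw [tripleValue_right_comm, tripleValue_eq_zero_of_add_lt _ (by omega), mul_zero]

lemma triple_eq_weightIntegral (q k₁ k₂ k₃ : ℕ) [NeZero q] :
    triple q k₁ k₂ k₃ =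
      weightIntegral q (basisPoly q k₁ * basisPoly q k₂ * basisPoly q k₃) := by
  simp only [triple, weightIntegral_apply, integral_weightMeasure, eval_mul]

lemma Gamma_add_natCast {a : ℝ} (ha : 0 < a) (n : ℕ) :
    Real.Gamma (a + n) = (ascPochhammer ℝ n).eval a * Real.Gamma a := by
  induction n with
  | zero => simp
  | succ n ih =>
    rw [Nat.cast_succ, ← add_assoc, Real.Gamma_add_one (by positivity), ih,
      ascPochhammer_succ_eval]
    ring

lemma linCoeff_eq_ascPochhammer {a : ℝ} (ha : 0 < a) (l i j : ℕ) :
    linCoeff l (l + i) (l + j) a =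
      (i + j + a) * (i + j).factorial * (ascPochhammer ℝ l).eval a * (ascPochhammer ℝ i).eval a *
          (ascPochhammer ℝ j).eval a * (ascPochhammer ℝ (l + i + j)).eval (2 * a) /
        (l.factorial * i.factorial * j.factorial * (ascPochhammer ℝ (i + j)).eval (2 * a) *
          (ascPochhammer ℝ (l + i + j + 1)).eval a) := by
  have ha2 : 0 < 2 * a := by positivity
  have hchoose : ((Nat.choose (l + i + (l + j) - 2 * l) (l + j - l) : ℕ) : ℝ) =
      (i + j).factorial / (i.factorial * j.factorial) := by
    rw [show l + i + (l + j) - 2 * l = i + j by omega, Nat.add_sub_cancel_left,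
      Nat.cast_choose ℝ (Nat.le_add_left j i), Nat.add_sub_cancel_right, mul_comm]
  have hΓ := (Real.Gamma_pos_of_pos ha).ne'
  have hsum := (ascPochhammer_pos (l + i + j) a ha).ne'
  rw [linCoeff, hchoose]
  simp only [beta]
  push_cast
  rw [show a + (l + i) - l = a + (i : ℝ) by ring, show a + (l + j) - l = a + (j : ℝ) by ring,
    show a + ((l : ℝ) + i) + (l + j) - l = a + (l + i + j : ℕ) by push_cast; ring,
    show a + (i : ℝ) + (a + j) = 2 * a + (i + j : ℕ) by push_cast; ring,
    show a + (l + i + j : ℕ) + a = 2 * a + (l + i + j : ℕ) by ring,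
    show (l : ℝ) + i + (l + j) + a - l = a + (l + i + j : ℕ) by push_cast; ring,
    show (l : ℝ) + i + (l + j) + a - 2 * l = i + j + a by ring, ascPochhammer_succ_eval]
  simp only [Gamma_add_natCast ha, Gamma_add_natCast ha2]
  field_simp

lemma linCoeff_mul_eq_tripleValue {a : ℝ} (ha : 0 < a) (l i j : ℕ) :
    linCoeff l (l + i) (l + j) a *
        (a / ((i + j : ℕ) + a) * ((ascPochhammer ℝ (i + j)).eval (2 * a) / (i + j).factorial)) =
      tripleValue a (l + i : ℕ) (l + j : ℕ) (i + j : ℕ) := by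
  rw [tripleValue_of_sum a (l + i + j : ℕ) _ _ _ (by push_cast; ring),
    show ((l + i + j : ℕ) : ℤ) - (l + i : ℕ) = (j : ℕ) by push_cast; ring,
    show ((l + i + j : ℕ) : ℤ) - (l + j : ℕ) = (i : ℕ) by push_cast; ring,
    show ((l + i + j : ℕ) : ℤ) - (i + j : ℕ) = (l : ℕ) by push_cast; ring,
    pochRatio_natCast, pochRatio_natCast, pochRatio_natCast, Int.toNat_natCast, pochQuot,
    linCoeff_eq_ascPochhammer ha]
  have hij2 := (ascPochhammer_pos (i + j) (2 * a) (by positivity)).ne'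
  have hden : (i : ℝ) + j + a ≠ 0 := by positivity
  generalize (ascPochhammer ℝ (i + j)).eval (2 * a) = c at *
  push_cast
  field_simp

lemma triple_one_of_le {k₁ k₂ k₃ : ℕ} (h12 : k₁ ≤ k₂) (h23 : k₂ ≤ k₃) :
    triple 1 k₁ k₂ k₃ =
      if k₃ = k₂ + k₁ ∨ k₃ = k₂ - k₁ then
        (1 + if k₁ = 0 then 1 else 0) / 2 * normConst 1 k₃ else 0 := by
  rw [triple_eq_weightIntegral, basisPoly_one, basisPoly_one, basisPoly_one,
    weightIntegral_chebyshev_mul_mul, normConst_one]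
  split_ifs <;> first | omega | ring

lemma triple_of_ne_of_le {q : ℕ} [NeZero q] (hq : q ≠ 1) {k₁ k₂ k₃ : ℕ} (h12 : k₁ ≤ k₂)
    (h23 : k₂ ≤ k₃) :
    triple q k₁ k₂ k₃ =
      if Odd (k₁ + k₂ + k₃) ∨ k₁ + k₂ < k₃ then 0 else
        linCoeff ((k₁ + k₂ - k₃) / 2) k₁ k₂ (((q : ℝ) - 1) / 2) * normConst q k₃ := by
  rw [triple_eq_weightIntegral, weightIntegral_basisPoly_mul_mul_of_ne hq]
  split_ifs with hk
  · rcases hk with hodd | hlt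
    · rw [tripleValue_of_not_even, mul_zero]
      exact_mod_cast Nat.not_even_iff_odd.2 hodd
    · rw [tripleValue_eq_zero_of_add_lt _ (by omega), mul_zero]
  · rw [not_or, Nat.not_odd_iff_even, not_lt] at hk
    obtain ⟨⟨s, hs⟩, hle⟩ := hk
    obtain ⟨l, i, j, rfl, rfl, rfl⟩ :
        ∃ l i j, k₁ = l + i ∧ k₂ = l + j ∧ k₃ = i + j :=
      ⟨s - k₃, s - k₂, s - k₁, by omega, by omega, by omega⟩
    rw [show (l + i + (l + j) - (i + j)) / 2 = l by omega, normConst_of_ne hq,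
      basisPoly_of_ne hq, gegenbauer_eval_one,
      ← linCoeff_mul_eq_tripleValue (half_pred_pos_of_ne hq)]
    ring

theorem triple_of_le (q : ℕ) [NeZero q] {k₁ k₂ k₃ : ℕ} (h12 : k₁ ≤ k₂) (h23 : k₂ ≤ k₃) :
    triple q k₁ k₂ k₃ =
      if q = 1 then
        (if k₃ = k₂ + k₁ ∨ k₃ = k₂ - k₁ then
          (1 + if k₁ = 0 then 1 else 0) / 2 * normConst 1 k₃ else 0)
      else
        (if Odd (k₁ + k₂ + k₃) ∨ k₁ + k₂ < k₃ then 0 else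
          linCoeff ((k₁ + k₂ - k₃) / 2) k₁ k₂ (((q : ℝ) - 1) / 2) * normConst q k₃) := by
  by_cases hq : q = 1
  · subst hq
    rw [if_pos rfl, triple_one_of_le h12 h23]
  · rw [if_neg hq, triple_of_ne_of_le hq h12 h23]

end TripleProducts

section FunkHeckeConstant

/-- The constant of the Funk–Hecke formula: integrating `f (x'u)` against `P_{k,q}(x'v)` over the
sphere multiplies `P_{k,q}(u'v)` by `heckeConst q k` times the `k`-th coefficient of `f`. -/
def heckeConst (q k : ℕ) : ℝ := area (q - 1) * normConst q k / (basisPoly q k).eval 1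

lemma heckeConst_mul_basisPoly_eval_one (q : ℕ) [NeZero q] (k : ℕ) :
    heckeConst q k * (basisPoly q k).eval 1 = area (q - 1) * normConst q k :=
  div_mul_cancel₀ _ (basisPoly_eval_one_pos q k).ne'

lemma area_zero : area 0 = 2 := by
  have hπ := (Real.rpow_pos_of_pos Real.pi_pos (1 / 2)).ne'
  simp only [area, Nat.cast_zero, zero_add, Real.Gamma_one_half_eq, Real.sqrt_eq_rpow]
  field_simp

lemma area_one : area 1 = 2 * Real.pi := by simp [area]

lemma heckeConst_one (k : ℕ) : heckeConst 1 k = (1 + if k = 0 then 1 else 0) * Real.pi := by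
  simp only [heckeConst, Nat.sub_self, area_zero, normConst_one, basisPoly_one,
    Chebyshev.T_eval_one]
  ring

lemma heckeConst_of_ne {q : ℕ} [NeZero q] (hq : q ≠ 1) (k : ℕ) :
    heckeConst q k = area q * (1 + 2 * (k : ℝ) / ((q : ℝ) - 1))⁻¹ := by
  have hpos := half_pred_pos_of_ne hq
  have heval := (basisPoly_eval_one_pos q k).ne'
  have harea := (area_pos (q - 1)).ne'
  have hq_ne : (q : ℝ) - 1 ≠ 0 := by linarith
  have hk_ne : 2 * (k : ℝ) + q - 1 ≠ 0 := by linarith [k.cast_nonneg (α := ℝ)]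
  rw [heckeConst, normConst_of_ne hq, show 1 + 2 * (k : ℝ) / ((q : ℝ) - 1) =
      (2 * k + q - 1) / (q - 1) by field_simp; ring,
    show (k : ℝ) + ((q : ℝ) - 1) / 2 = (2 * k + q - 1) / 2 by ring]
  field_simp

lemma area_sq_mul_zeta (q : ℕ) [NeZero q] (k₁ k₂ : ℕ) :
    area q ^ 2 * zeta q k₁ k₂ = heckeConst q k₁ * heckeConst q k₂ * area (q - 1) := by
  by_cases hq : q = 1
  · subst hq
    simp only [heckeConst_one, zeta, area_one, if_true, Nat.sub_self, area_zero]
    ring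
  · rw [heckeConst_of_ne hq, heckeConst_of_ne hq, zeta, if_neg hq]
    ring

lemma area_sq_mul_tau (q : ℕ) [NeZero q] (k : ℕ) :
    area q ^ 2 * tau q k = heckeConst q k * (area (q - 1) * normConst q k) := by
  rw [← heckeConst_mul_basisPoly_eval_one]
  by_cases hq : q = 1
  · subst hq
    simp only [heckeConst_one, tau, area_one, if_true, basisPoly_one, Chebyshev.T_eval_one]
    ring
  · rw [heckeConst_of_ne hq, tau, if_neg hq, basisPoly_eval_one_of_ne hq, ← inv_pow]
    ring

lemma exists_basisPoly_eval_one_div_normConst_le (q : ℕ) [NeZero q] :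
    ∃ A : ℝ, 0 ≤ A ∧ ∀ k, (basisPoly q k).eval 1 / normConst q k ≤ A * ((k : ℝ) + 1) := by
  by_cases hq : q = 1
  · subst hq
    refine ⟨1, zero_le_one, fun k => ?_⟩
    have hπ := Real.pi_gt_three
    have := k.cast_nonneg (α := ℝ)
    rw [div_le_iff₀ (normConst_pos 1 k), basisPoly_one, normConst_one, Chebyshev.T_eval_one]
    split_ifs <;> nlinarith
  · have ha := half_pred_pos_of_ne hq
    have hω := area_pos q
    have hω' := area_pos (q - 1)
    set a := ((q : ℝ) - 1) / 2 with ha_def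
    refine ⟨area (q - 1) / area q * ((1 + a) / a), by positivity, fun k => ?_⟩
    have heval := (basisPoly_eval_one_pos q k).ne'
    have := k.cast_nonneg (α := ℝ)
    calc (basisPoly q k).eval 1 / normConst q k
        = area (q - 1) / area q * ((k + a) / a) := by
          rw [normConst_of_ne hq, ← ha_def]
          field_simp
      _ ≤ area (q - 1) / area q * ((1 + a) * (k + 1) / a) := by
          gcongr
          nlinarith
      _ = area (q - 1) / area q * ((1 + a) / a) * (k + 1) := by ring

end FunkHeckeConstant

section SphereGeometry

variable {q : ℕ}

lemma dot_mem_Icc (x y : Sphere q) : dot x y ∈ Set.Icc (-1 : ℝ) 1 :=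
  abs_le.1 (by simpa [dot] using abs_real_inner_le_norm (x : Ambient q) (y : Ambient q))

lemma continuous_dot : Continuous fun p : Sphere q × Sphere q => dot p.1 p.2 := by
  unfold dot
  fun_prop

@[fun_prop]
lemma continuous_dot_right (x : Sphere q) : Continuous fun y => dot x y := by
  unfold dot
  fun_prop

@[fun_prop]
lemma continuous_dot_left (y : Sphere q) : Continuous fun x => dot x y := by
  unfold dot
  fun_prop

lemma integrable_surface_of_continuous {f : Sphere q → ℝ} (hf : Continuous f) :
    Integrable f (surface q) :=
  hf.integrable_of_hasCompactSupport (HasCompactSupport.of_compactSpace f)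

variable [NeZero q]

lemma exists_dot_eq_zero (x : Sphere q) : ∃ v : Sphere q, dot x v = 0 := by
  have hfinrank : Module.finrank ℝ ((ℝ ∙ (x : Ambient q))ᗮ) = q := by
    have : Fact (Module.finrank ℝ (Ambient q) = q + 1) := ⟨by simp⟩
    exact Submodule.finrank_orthogonal_span_singleton (ne_zero_of_mem_unit_sphere x)
  have hne : (ℝ ∙ (x : Ambient q))ᗮ ≠ ⊥ := fun hbot =>
    NeZero.ne q (by rw [← hfinrank, hbot, finrank_bot])
  obtain ⟨w, hw, hw0⟩ := Submodule.exists_mem_ne_zero_of_ne_bot hne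
  rw [Submodule.mem_orthogonal_singleton_iff_inner_right] at hw
  refine ⟨⟨‖w‖⁻¹ • w, by simp [norm_smul, hw0]⟩, ?_⟩
  simp [dot, inner_smul_right, hw]

lemma exists_dot_eq_zero_and_eq_add (x m : Sphere q) :
    ∃ v : Sphere q, dot x v = 0 ∧
      (m : Ambient q) = dot x m • (x : Ambient q) + √(1 - dot x m ^ 2) • (v : Ambient q) := by
  set s := dot x m
  set w : Ambient q := m - s • (x : Ambient q) with hw
  have hxx : inner ℝ (x : Ambient q) x = 1 := dot_self x
  have hmm : inner ℝ (m : Ambient q) m = 1 := dot_self m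
  have hxm : inner ℝ (x : Ambient q) m = s := rfl
  have hmx : inner ℝ (m : Ambient q) x = s := dot_comm m x
  have hxw : inner ℝ (x : Ambient q) w = 0 := by
    rw [hw, inner_sub_right, inner_smul_right, hxx, hxm, mul_one, sub_self]
  have hnorm : ‖w‖ = √(1 - s ^ 2) := by
    rw [← Real.sqrt_sq (norm_nonneg w), ← real_inner_self_eq_norm_sq, hw, inner_sub_sub_self]
    simp only [inner_smul_right, inner_smul_left, hxx, hmm, hxm, hmx, conj_trivial]
    ring_nf
  by_cases hw0 : w = 0
  · obtain ⟨v, hv⟩ := exists_dot_eq_zero x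
    refine ⟨v, hv, ?_⟩
    rw [← hnorm, hw0, norm_zero, zero_smul, add_zero]
    exact sub_eq_zero.1 hw0
  · refine ⟨⟨‖w‖⁻¹ • w, by simp [norm_smul, hw0]⟩, by simp [dot, inner_smul_right, hxw], ?_⟩
    rw [← hnorm, smul_smul, mul_inv_cancel₀ (norm_ne_zero_iff.2 hw0), one_smul, hw,
      add_sub_cancel]

lemma exists_dot_eq (x : Sphere q) {t : ℝ} (ht : t ∈ Set.Icc (-1 : ℝ) 1) :
    ∃ m : Sphere q, dot x m = t := by
  obtain ⟨v, hv⟩ := exists_dot_eq_zero x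
  have hxx : inner ℝ (x : Ambient q) x = 1 := dot_self x
  have hvv : inner ℝ (v : Ambient q) v = 1 := dot_self v
  have hxv : inner ℝ (x : Ambient q) v = 0 := hv
  have hvx : inner ℝ (v : Ambient q) x = 0 := (dot_comm v x).trans hv
  have hnonneg : 0 ≤ 1 - t ^ 2 := by nlinarith [ht.1, ht.2]
  have hnorm : ‖t • (x : Ambient q) + √(1 - t ^ 2) • (v : Ambient q)‖ = 1 := by
    rw [← Real.sqrt_sq (norm_nonneg _), ← real_inner_self_eq_norm_sq, Real.sqrt_eq_one]
    simp only [inner_add_left, inner_add_right, inner_smul_left, inner_smul_right, hxx, hvv, hxv,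
      hvx, conj_trivial]
    linear_combination Real.mul_self_sqrt hnonneg
  refine ⟨⟨t • (x : Ambient q) + √(1 - t ^ 2) • (v : Ambient q), by simp [hnorm]⟩, ?_⟩
  simp [dot, inner_add_right, inner_smul_right, hxv]

end SphereGeometry

section SliceMeans

/-- The slice mean of `X ^ i`: for `x'm = s`, its value at `t` is the mean of `(m'y) ^ i` over the
slice `x'y = t` of the sphere. It comes from the binomial expansion of
`m'y = s t + √(1 - s²) v'y`, where `v` is orthogonal to `x`; the odd powers of `v'y` have mean
zero. -/
def sliceMeanXPow (q : ℕ) (s : ℝ) (i : ℕ) : ℝ[X] :=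
  ∑ b ∈ Finset.range (i + 1) with Even b,
    (Nat.choose i b * coordMoment q (b / 2) * (1 - s ^ 2) ^ (b / 2) * s ^ (i - b)) •
      (X ^ (i - b) * (1 - X ^ 2) ^ (b / 2))

/-- The slice mean of a polynomial `f`: for `x'm = s`, its value at `t` is the mean of `f (m'y)`
over the slice `x'y = t` of the sphere. -/
def sliceMean (q : ℕ) (s : ℝ) : ℝ[X] →ₗ[ℝ] ℝ[X] :=
  Polynomial.lsum fun i => LinearMap.toSpanSingleton ℝ ℝ[X] (sliceMeanXPow q s i)

lemma sliceMean_monomial (q : ℕ) (s : ℝ) (i : ℕ) (c : ℝ) :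
    sliceMean q s (monomial i c) = c • sliceMeanXPow q s i := by
  simp [sliceMean, Polynomial.lsum_apply, Polynomial.sum_monomial_index]

lemma natDegree_sliceMeanXPow_le (q : ℕ) (s : ℝ) (i : ℕ) :
    (sliceMeanXPow q s i).natDegree ≤ i := by
  refine natDegree_sum_le_of_forall_le _ _ fun b hb => ?_
  have hb_le : b < i + 1 := Finset.mem_range.1 (Finset.mem_filter.1 hb).1
  have hpow : ((1 - X ^ 2 : ℝ[X]) ^ (b / 2)).natDegree ≤ b / 2 * 2 :=
    natDegree_pow_le_of_le _ ((natDegree_sub_le _ _).trans (by simp))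
  refine (natDegree_smul_le _ _).trans (natDegree_mul_le.trans ?_)
  rw [natDegree_X_pow]
  omega

lemma natDegree_sliceMean_le (q : ℕ) (s : ℝ) (f : ℝ[X]) :
    (sliceMean q s f).natDegree ≤ f.natDegree := by
  conv_lhs => rw [f.as_sum_range, map_sum]
  refine natDegree_sum_le_of_forall_le _ _ fun i hi => ?_
  rw [sliceMean_monomial]
  exact (natDegree_smul_le _ _).trans
    ((natDegree_sliceMeanXPow_le q s i).trans (Nat.lt_succ_iff.1 (Finset.mem_range.1 hi)))

variable {q : ℕ} [NeZero q]

lemma sliceMeanXPow_eval_one (s : ℝ) (i : ℕ) : (sliceMeanXPow q s i).eval 1 = s ^ i := by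
  rw [sliceMeanXPow, eval_finsetSum, Finset.sum_eq_single 0]
  · simp
  · intro b hb hb0
    obtain ⟨c, rfl⟩ := (Finset.mem_filter.1 hb).2
    have hhalf : (c + c) / 2 ≠ 0 := by omega
    simp [hhalf]
  · simp

lemma sliceMean_eval_one (s : ℝ) (f : ℝ[X]) : (sliceMean q s f).eval 1 = f.eval s := by
  induction f using Polynomial.induction_on' with
  | add p r hp hr => simp [hp, hr]
  | monomial i c =>
    rw [sliceMean_monomial, eval_smul, sliceMeanXPow_eval_one, eval_monomial, smul_eq_mul]

lemma integral_surface_dot_pow_mul_dot_pow_eq_sliceMeanXPow (x m : Sphere q) (a i : ℕ) :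
    ∫ y, dot x y ^ a * dot m y ^ i ∂surface q =
      area (q - 1) * weightIntegral q (X ^ a * sliceMeanXPow q (dot x m) i) := by
  obtain ⟨v, hxv, hm⟩ := exists_dot_eq_zero_and_eq_add x m
  set s := dot x m
  have hs : 0 ≤ 1 - s ^ 2 := by nlinarith [(dot_mem_Icc x m).1, (dot_mem_Icc x m).2]
  have hdot : ∀ y : Sphere q, dot m y = √(1 - s ^ 2) * dot v y + s * dot x y := by
    intro y
    simp only [dot]
    rw [hm, inner_add_left, inner_smul_left, inner_smul_left, add_comm]
    rfl
  have hexpand : ∀ y : Sphere q, dot x y ^ a * dot m y ^ i =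
      ∑ b ∈ Finset.range (i + 1), (Nat.choose i b * √(1 - s ^ 2) ^ b * s ^ (i - b)) *
        (dot x y ^ (a + (i - b)) * dot v y ^ b) := by
    intro y
    rw [hdot y, add_pow, Finset.mul_sum]
    refine Finset.sum_congr rfl fun b _ => ?_
    rw [mul_pow, mul_pow, pow_add]
    ring
  simp_rw [hexpand]
  rw [integral_finsetSum _ fun b _ => integrable_surface_of_continuous (by fun_prop),
    sliceMeanXPow, Finset.sum_filter, Finset.mul_sum, map_sum, Finset.mul_sum]
  refine Finset.sum_congr rfl fun b _ => ?_
  rw [integral_const_mul]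
  split_ifs with hb
  · obtain ⟨e, rfl⟩ := hb
    rw [← two_mul, integral_surface_dot_pow_mul_dot_pow_two_mul hxv,
      Nat.mul_div_cancel_left e two_pos, pow_mul (√(1 - s ^ 2)), Real.sq_sqrt hs, mul_smul_comm,
      map_smul, smul_eq_mul, pow_add, mul_assoc (X ^ a)]
    ring
  · rw [integral_surface_dot_pow_mul_dot_pow_of_odd hxv _ (Nat.not_even_iff_odd.1 hb), mul_zero,
      mul_zero, map_zero, mul_zero]

lemma integral_surface_eval_dot_mul_eval_dot (x m : Sphere q) (p f : ℝ[X]) :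
    ∫ y, p.eval (dot x y) * f.eval (dot m y) ∂surface q =
      area (q - 1) * weightIntegral q (p * sliceMean q (dot x m) f) := by
  have hint : ∀ p f : ℝ[X],
      Integrable (fun y => p.eval (dot x y) * f.eval (dot m y)) (surface q) :=
    fun p f => integrable_surface_of_continuous (by fun_prop)
  induction f using Polynomial.induction_on' with
  | add f r hf hr =>
    simp only [eval_add, mul_add, map_add]
    rw [integral_add (hint p f) (hint p r), hf, hr]
  | monomial i c =>
    induction p using Polynomial.induction_on' with
    | add p r hp hr =>
      simp only [eval_add, add_mul, map_add]
      rw [integral_add (hint p _) (hint r _), hp, hr, mul_add]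
    | monomial a d =>
      simp only [eval_monomial, mul_mul_mul_comm d, integral_const_mul]
      rw [integral_surface_dot_pow_mul_dot_pow_eq_sliceMeanXPow, sliceMean_monomial,
        mul_smul_comm, ← C_mul_X_pow_eq_monomial, ← smul_eq_C_mul, smul_mul_assoc, map_smul,
        map_smul, smul_eq_mul, smul_eq_mul]
      ring

end SliceMeans

section FunkHecke

lemma eq_sum_basisPoly (q : ℕ) [NeZero q] {p : ℝ[X]} {n : ℕ} (hp : p.degree < n) :
    p = ∑ j ∈ Finset.range n,
      (weightIntegral q (p * basisPoly q j) / normConst q j) • basisPoly q j := by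
  have hspan := mem_span_basisPoly q hp
  clear hp
  induction hspan using Submodule.span_induction with
  | mem _ hmem =>
    obtain ⟨k, hk, rfl⟩ := hmem
    rw [Finset.sum_eq_single k]
    · rw [weightIntegral_basisPoly_mul, if_pos rfl, div_self (normConst_pos q k).ne', one_smul]
    · intro j _ hj
      rw [weightIntegral_basisPoly_mul, if_neg hj.symm, zero_div, zero_smul]
    · exact fun hk' => absurd (Finset.mem_range.2 hk) hk'
  | zero => simp
  | add p r _ _ hp hr =>
    simp only [add_mul, map_add, add_div, add_smul, Finset.sum_add_distrib]
    rw [← hp, ← hr]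
  | smul c p _ hp =>
    simp only [smul_mul_assoc, map_smul, smul_eq_mul, mul_div_assoc, mul_smul, ← Finset.smul_sum]
    rw [← hp]

lemma weightIntegral_mul_basisPoly_of_degree_lt (q : ℕ) [NeZero q] {p : ℝ[X]} {k : ℕ}
    (hp : p.degree < k) : weightIntegral q (p * basisPoly q k) = 0 := by
  rw [eq_sum_basisPoly q hp, Finset.sum_mul, map_sum]
  refine Finset.sum_eq_zero fun j hj => ?_
  rw [smul_mul_assoc, map_smul, weightIntegral_basisPoly_mul, if_neg (Finset.mem_range.1 hj).ne,
    smul_zero]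

variable {q : ℕ} [NeZero q]

-- The slice mean of `P_k` is orthogonal to `P_j` for `j < k`: exchanging the roles of `x` and `m`
-- turns this pairing into that of `P_k` with the slice mean of `P_j`, of degree at most `j`.
lemma sliceMean_basisPoly (x m : Sphere q) (k : ℕ) :
    sliceMean q (dot x m) (basisPoly q k) =
      ((basisPoly q k).eval (dot x m) / (basisPoly q k).eval 1) • basisPoly q k := by
  set K := sliceMean q (dot x m) (basisPoly q k) with hK
  have hdeg : K.degree < (k + 1 : ℕ) :=
    (degree_le_of_natDegree_le ((natDegree_sliceMean_le q _ _).trans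
      (natDegree_basisPoly q k).le)).trans_lt (WithBot.coe_lt_coe.2 k.lt_succ_self)
  have horth : ∀ j < k, weightIntegral q (K * basisPoly q j) = 0 := by
    intro j hj
    have hdeg_lt : (sliceMean q (dot m x) (basisPoly q j)).degree < k :=
      (degree_le_of_natDegree_le ((natDegree_sliceMean_le q _ _).trans
        (natDegree_basisPoly q j).le)).trans_lt (WithBot.coe_lt_coe.2 hj)
    have hxm := integral_surface_eval_dot_mul_eval_dot x m (basisPoly q j) (basisPoly q k)
    have hmx := integral_surface_eval_dot_mul_eval_dot m x (basisPoly q k) (basisPoly q j)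
    rw [mul_comm (basisPoly q k), weightIntegral_mul_basisPoly_of_degree_lt q hdeg_lt,
      mul_zero] at hmx
    simp_rw [mul_comm (eval _ (basisPoly q k))] at hmx
    rw [hmx, ← hK, mul_comm (basisPoly q j)] at hxm
    exact (mul_eq_zero.1 hxm.symm).resolve_left (area_pos (q - 1)).ne'
  have hsmul := eq_sum_basisPoly q hdeg
  rw [Finset.sum_range_succ, Finset.sum_eq_zero (fun j hj => by
    rw [horth j (Finset.mem_range.1 hj), zero_div, zero_smul]), zero_add] at hsmul
  have heval := congrArg (eval 1) hsmul
  rw [hK, sliceMean_eval_one, eval_smul, smul_eq_mul, ← hK] at heval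
  rw [heval, mul_div_cancel_right₀ _ (basisPoly_eval_one_pos q k).ne']
  exact hsmul

theorem integral_surface_basisPoly_dot_mul_eval_dot (x m : Sphere q) (k : ℕ) (f : ℝ[X]) :
    ∫ y, (basisPoly q k).eval (dot x y) * f.eval (dot m y) ∂surface q =
      area (q - 1) / (basisPoly q k).eval 1 * (basisPoly q k).eval (dot x m) *
        weightIntegral q (f * basisPoly q k) := by
  simp_rw [mul_comm (eval _ (basisPoly q k)) (eval _ f)]
  rw [integral_surface_eval_dot_mul_eval_dot m x f, sliceMean_basisPoly, mul_smul_comm, map_smul,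
    smul_eq_mul, dot_comm m x]
  ring

lemma integral_surface_basisPoly_dot_mul_self (x m : Sphere q) (k : ℕ) :
    ∫ y, (basisPoly q k).eval (dot x y) * (basisPoly q k).eval (dot m y) ∂surface q =
      heckeConst q k * (basisPoly q k).eval (dot x m) := by
  rw [integral_surface_basisPoly_dot_mul_eval_dot, weightIntegral_basisPoly_mul, if_pos rfl,
    heckeConst]
  ring

-- By the reproducing identity above, this is the Cauchy–Schwarz inequality for the functions
-- `y ↦ P_k(x'y)` and `y ↦ P_k(m'y)`, where `x'm = t`.
lemma abs_basisPoly_eval_le (k : ℕ) {t : ℝ} (ht : t ∈ Set.Icc (-1 : ℝ) 1) :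
    |(basisPoly q k).eval t| ≤ (basisPoly q k).eval 1 := by
  set p := basisPoly q k
  obtain ⟨x⟩ : Nonempty (Sphere q) := ⟨⟨EuclideanSpace.single 0 1, by simp⟩⟩
  obtain ⟨m, rfl⟩ := exists_dot_eq x ht
  have hhecke : 0 < heckeConst q k :=
    div_pos (mul_pos (area_pos _) (normConst_pos q k)) (basisPoly_eval_one_pos q k)
  have hsq : ∀ z : Sphere q,
      ∫ y, p.eval (dot z y) ^ 2 ∂surface q = heckeConst q k * p.eval 1 := by
    intro z
    have h := integral_surface_basisPoly_dot_mul_self z z k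
    rw [dot_self] at h
    simpa only [sq] using h
  have hint : ∀ z : Sphere q, Integrable (fun y => p.eval (dot z y) ^ 2) (surface q) :=
    fun z => integrable_surface_of_continuous (by fun_prop)
  refine le_of_mul_le_mul_left ?_ hhecke
  calc heckeConst q k * |p.eval (dot x m)|
      = |∫ y, p.eval (dot x y) * p.eval (dot m y) ∂surface q| := by
        rw [integral_surface_basisPoly_dot_mul_self, abs_mul, abs_of_pos hhecke]
    _ ≤ ∫ y, |p.eval (dot x y) * p.eval (dot m y)| ∂surface q := abs_integral_le_integral_abs
    _ ≤ ∫ y, (p.eval (dot x y) ^ 2 + p.eval (dot m y) ^ 2) / 2 ∂surface q := by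
        refine integral_mono (integrable_surface_of_continuous (by fun_prop))
          (((hint x).add (hint m)).div_const 2) fun y => ?_
        simp only [abs_mul]
        linarith [two_mul_le_add_sq |p.eval (dot x y)| |p.eval (dot m y)|,
          sq_abs (p.eval (dot x y)), sq_abs (p.eval (dot m y))]
    _ = heckeConst q k * p.eval 1 := by
        rw [integral_div, integral_add (hint x) (hint m), hsq, hsq]
        ring

end FunkHecke

section PolynomialDensity

variable {μ : Measure ℝ} [IsFiniteMeasure μ] {a b : ℝ}

lemma integrable_of_continuous_of_ae_mem_Icc (hμ : ∀ᵐ x ∂μ, x ∈ Set.Icc a b) {f : ℝ → ℝ}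
    (hf : Continuous f) : Integrable f μ := by
  obtain ⟨D, hD⟩ := (isCompact_Icc (a := a) (b := b)).exists_bound_of_continuousOn hf.continuousOn
  exact Integrable.of_bound hf.aestronglyMeasurable D (hμ.mono hD)

lemma exists_polynomial_integral_abs_sub_le (hμ : ∀ᵐ x ∂μ, x ∈ Set.Icc a b) {f : ℝ → ℝ}
    (hf : Integrable f μ) {ε : ℝ} (hε : 0 < ε) : ∃ p : ℝ[X], ∫ x, |f x - p.eval x| ∂μ ≤ ε := by
  obtain ⟨g, hfg, hg⟩ := hf.exists_boundedContinuous_integral_sub_le (half_pos hε)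
  have hmass : 0 < μ.real Set.univ + 1 := by positivity
  obtain ⟨p, hp⟩ := exists_polynomial_near_of_continuousOn a b g g.continuous.continuousOn
    (ε / 2 / (μ.real Set.univ + 1)) (by positivity)
  have hgp : ∀ᵐ x ∂μ, ‖g x - p.eval x‖ ≤ ε / 2 / (μ.real Set.univ + 1) :=
    hμ.mono fun x hx => by
      rw [Real.norm_eq_abs, abs_sub_comm]
      exact (hp x hx).le
  have hpint : Integrable (fun x => p.eval x) μ :=
    integrable_of_continuous_of_ae_mem_Icc hμ p.continuous
  refine ⟨p, ?_⟩
  calc ∫ x, |f x - p.eval x| ∂μ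
      ≤ ∫ x, (‖f x - g x‖ + ‖g x - p.eval x‖) ∂μ :=
        integral_mono (hf.sub hpint).abs ((hf.sub hg).norm.add (hg.sub hpint).norm)
          fun x => abs_sub_le _ _ _
    _ = ∫ x, ‖f x - g x‖ ∂μ + ∫ x, ‖g x - p.eval x‖ ∂μ :=
        integral_add (hf.sub hg).norm (hg.sub hpint).norm
    _ ≤ ε / 2 + ε / 2 / (μ.real Set.univ + 1) * μ.real Set.univ := by
        refine add_le_add hfg ((Real.le_norm_self _).trans (norm_integral_le_of_norm_le_const ?_))
        simpa only [norm_norm] using hgp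
    _ ≤ ε / 2 + ε / 2 := by
        gcongr
        rw [div_mul_eq_mul_div, div_le_iff₀ hmass]
        nlinarith
    _ = ε := add_halves ε

lemma measure_ext_of_forall_integral_polynomial {ν : Measure ℝ} [IsFiniteMeasure ν]
    (hμ : ∀ᵐ x ∂μ, x ∈ Set.Icc a b) (hν : ∀ᵐ x ∂ν, x ∈ Set.Icc a b)
    (h : ∀ p : ℝ[X], ∫ x, p.eval x ∂μ = ∫ x, p.eval x ∂ν) : μ = ν := by
  refine ext_of_forall_integral_eq_of_IsFiniteMeasure fun f => eq_of_forall_dist_le fun ε hε => ?_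
  obtain ⟨p, hp⟩ := exists_polynomial_integral_abs_sub_le (ae_add_measure_iff.2 ⟨hμ, hν⟩)
    (f.integrable (μ + ν)) hε
  have hpμ : Integrable (fun x => p.eval x) μ :=
    integrable_of_continuous_of_ae_mem_Icc hμ p.continuous
  have hpν : Integrable (fun x => p.eval x) ν :=
    integrable_of_continuous_of_ae_mem_Icc hν p.continuous
  have hsplit := integral_add_measure ((f.integrable μ).sub hpμ).abs ((f.integrable ν).sub hpν).abs
  calc dist (∫ x, f x ∂μ) (∫ x, f x ∂ν)
      = |∫ x, (f x - p.eval x) ∂μ - ∫ x, (f x - p.eval x) ∂ν| := by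
        rw [integral_sub (f.integrable μ) hpμ, integral_sub (f.integrable ν) hpν, h p,
          sub_sub_sub_cancel_right, Real.dist_eq]
    _ ≤ ∫ x, |f x - p.eval x| ∂μ + ∫ x, |f x - p.eval x| ∂ν :=
        (abs_sub _ _).trans (add_le_add abs_integral_le_integral_abs abs_integral_le_integral_abs)
    _ ≤ ε := hsplit.symm.trans_le hp

end PolynomialDensity

section ZonalFunctions

variable {q : ℕ} [NeZero q] (m : Sphere q) {g : ℝ → ℝ}

theorem measurePreserving_dot :
    MeasurePreserving (dot m) (surface q) (ENNReal.ofReal (area (q - 1)) • weightMeasure q) := by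
  have hmeas : Measurable (dot m) := (continuous_dot_right m).measurable
  refine ⟨hmeas, ?_⟩
  have : IsFiniteMeasure (ENNReal.ofReal (area (q - 1)) • weightMeasure q) :=
    (weightMeasure q).smul_finite ENNReal.ofReal_ne_top
  refine measure_ext_of_forall_integral_polynomial (a := -1) (b := 1)
    ((ae_map_iff hmeas.aemeasurable measurableSet_Icc).2 (.of_forall (dot_mem_Icc m)))
    (Measure.ae_smul_measure (ae_mem_Icc_weightMeasure q) _) fun p => ?_
  have h := integral_surface_basisPoly_dot_mul_eval_dot m m 0 p
  rw [basisPoly_zero] at h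
  simp only [eval_one, one_mul, div_one, mul_one] at h
  rw [integral_map hmeas.aemeasurable p.continuous.aestronglyMeasurable, h,
    integral_smul_measure, ENNReal.toReal_ofReal (area_pos _).le, smul_eq_mul,
    weightIntegral_apply]

lemma ae_comp_dot {s : ℝ → Prop} (h : ∀ᵐ t ∂weightMeasure q, s t) :
    ∀ᵐ y ∂surface q, s (dot m y) :=
  (measurePreserving_dot m).quasiMeasurePreserving.ae (Measure.ae_smul_measure h _)

lemma integrable_comp_dot (hg : Integrable g (weightMeasure q)) :
    Integrable (fun y => g (dot m y)) (surface q) :=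
  (measurePreserving_dot m).integrable_comp_of_integrable (hg.smul_measure ENNReal.ofReal_ne_top)

lemma integral_comp_dot (hg : AEStronglyMeasurable g (weightMeasure q)) :
    ∫ y, g (dot m y) ∂surface q = area (q - 1) * ∫ t, g t ∂weightMeasure q := by
  have hmp := measurePreserving_dot m
  rw [← integral_map hmp.measurable.aemeasurable (by rw [hmp.map_eq]; exact hg.smul_measure _),
    hmp.map_eq, integral_smul_measure, ENNReal.toReal_ofReal (area_pos _).le, smul_eq_mul]

lemma integrable_basisPoly_mul (hg : Integrable g (weightMeasure q)) (k : ℕ) :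
    Integrable (fun t => (basisPoly q k).eval t * g t) (weightMeasure q) :=
  hg.bdd_mul (basisPoly q k).continuous.aestronglyMeasurable
    ((ae_mem_Icc_weightMeasure q).mono fun _ => abs_basisPoly_eval_le k)

lemma abs_integral_basisPoly_mul_le (hg : Integrable g (weightMeasure q)) (k : ℕ) :
    |∫ t, (basisPoly q k).eval t * g t ∂weightMeasure q| ≤
      (basisPoly q k).eval 1 * ∫ t, |g t| ∂weightMeasure q := by
  rw [← integral_const_mul]
  refine abs_integral_le_integral_abs.trans
    (integral_mono_ae (integrable_basisPoly_mul hg k).abs (hg.abs.const_mul _) ?_)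
  filter_upwards [ae_mem_Icc_weightMeasure q] with t ht
  rw [abs_mul]
  exact mul_le_mul_of_nonneg_right (abs_basisPoly_eval_le k ht) (abs_nonneg _)

lemma integrable_basisPoly_dot_mul (hg : Integrable g (weightMeasure q)) (x : Sphere q) (k : ℕ) :
    Integrable (fun y => (basisPoly q k).eval (dot x y) * g (dot m y)) (surface q) :=
  (integrable_comp_dot m hg).bdd_mul (Continuous.aestronglyMeasurable (by fun_prop))
    (.of_forall fun y => abs_basisPoly_eval_le k (dot_mem_Icc x y))

lemma abs_integral_basisPoly_dot_mul_le (hg : Integrable g (weightMeasure q)) (x : Sphere q)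
    (k : ℕ) :
    |∫ y, (basisPoly q k).eval (dot x y) * g (dot m y) ∂surface q| ≤
      area (q - 1) * (basisPoly q k).eval 1 * ∫ t, |g t| ∂weightMeasure q := by
  rw [mul_comm (area _), mul_assoc, ← integral_comp_dot m hg.abs.aestronglyMeasurable,
    ← integral_const_mul]
  refine abs_integral_le_integral_abs.trans (integral_mono
    (integrable_basisPoly_dot_mul m hg x k).abs ((integrable_comp_dot m hg.abs).const_mul _)
    fun y => ?_)
  simp only [abs_mul]
  exact mul_le_mul_of_nonneg_right (abs_basisPoly_eval_le k (dot_mem_Icc x y)) (abs_nonneg _)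

-- Both sides are continuous in `g` for the weighted `L¹` norm, so it suffices to know the formula
-- for polynomials.
theorem funk_hecke (hg : Integrable g (weightMeasure q)) (x : Sphere q) (k : ℕ) :
    ∫ y, (basisPoly q k).eval (dot x y) * g (dot m y) ∂surface q =
      area (q - 1) / (basisPoly q k).eval 1 * (basisPoly q k).eval (dot x m) *
        ∫ t, (basisPoly q k).eval t * g t ∂weightMeasure q := by
  have hP := basisPoly_eval_one_pos q k
  have hA := area_pos (q - 1)
  refine eq_of_forall_dist_le fun ε hε => ?_
  obtain ⟨p, hp⟩ := exists_polynomial_integral_abs_sub_le (ae_mem_Icc_weightMeasure q) hg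
    (ε := ε / (2 * (area (q - 1) * (basisPoly q k).eval 1))) (by positivity)
  have hpint : Integrable (fun t => p.eval t) (weightMeasure q) :=
    integrable_weightMeasure_of_continuousOn q p.continuousOn
  have hpoly := integral_surface_basisPoly_dot_mul_eval_dot x m k p
  have hsphere := abs_integral_basisPoly_dot_mul_le m (hg.sub hpint) x k
  have hweight := abs_integral_basisPoly_mul_le (hg.sub hpint) k
  simp only [Pi.sub_apply, mul_sub] at hsphere hweight
  rw [integral_sub (integrable_basisPoly_dot_mul m hg x k)
    (integrable_basisPoly_dot_mul m hpint x k), hpoly] at hsphere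
  rw [integral_sub (integrable_basisPoly_mul hg k) (integrable_basisPoly_mul hpint k)] at hweight
  simp only [weightIntegral_apply, eval_mul, mul_comm (eval _ p)] at hsphere
  have hscaled : |area (q - 1) / (basisPoly q k).eval 1 * (basisPoly q k).eval (dot x m)| ≤
      area (q - 1) := by
    rw [abs_mul, abs_of_pos (div_pos hA hP), div_mul_eq_mul_div, div_le_iff₀ hP]
    exact mul_le_mul_of_nonneg_left (abs_basisPoly_eval_le k (dot_mem_Icc x m)) hA.le
  rw [Real.dist_eq]
  set c := area (q - 1) / (basisPoly q k).eval 1 * (basisPoly q k).eval (dot x m)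
  set δ := ∫ t, |g t - p.eval t| ∂weightMeasure q
  calc _ ≤ area (q - 1) * (basisPoly q k).eval 1 * δ +
        area (q - 1) * ((basisPoly q k).eval 1 * δ) := by
        refine (abs_sub_le _ (c * ∫ t, (basisPoly q k).eval t * p.eval t ∂weightMeasure q) _).trans
          (add_le_add hsphere ?_)
        rw [← mul_sub, abs_mul, abs_sub_comm]
        exact mul_le_mul hscaled hweight (abs_nonneg _) hA.le
    _ = 2 * (area (q - 1) * (basisPoly q k).eval 1) * δ := by ring
    _ ≤ ε := by
        rw [← le_div_iff₀' (by positivity)]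
        exact hp

end ZonalFunctions

section AnalyticExtension

/-- A function on `[-1, 1]` that extends holomorphically to a disc of radius larger than `1`. This
is what makes the Gegenbauer coefficients of the test kernels decay geometrically. -/
def ExtendsAnalytically (F : ℝ → ℝ) : Prop :=
  ∃ R : ℝ, 1 < R ∧ ∃ f : ℂ → ℂ, DifferentiableOn ℂ f (Metric.closedBall 0 R) ∧
    ∀ x ∈ Set.Icc (-1 : ℝ) 1, f x = F x

variable {F : ℝ → ℝ}

lemma ExtendsAnalytically.sq (hF : ExtendsAnalytically F) :
    ExtendsAnalytically fun x => F x ^ 2 := by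
  obtain ⟨R, hR, f, hf, hfF⟩ := hF
  exact ⟨R, hR, fun z => f z ^ 2, hf.pow 2, fun x hx => by simp [hfF x hx]⟩

lemma ExtendsAnalytically.continuousOn (hF : ExtendsAnalytically F) :
    ContinuousOn F (Set.Icc (-1) 1) := by
  obtain ⟨R, hR, f, hf, hfF⟩ := hF
  have hre : ContinuousOn (fun x : ℝ => (f x).re) (Set.Icc (-1) 1) := by
    refine Complex.continuous_re.comp_continuousOn
      (hf.continuousOn.comp Complex.continuous_ofReal.continuousOn fun x hx => ?_)
    rw [mem_closedBall_zero_iff, Complex.norm_real, Real.norm_eq_abs]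
    exact (abs_le.2 hx).trans hR.le
  exact hre.congr fun x hx => by simp only [hfF x hx, Complex.ofReal_re]

lemma extendsAnalytically_smoothMaxKernel (κ : ℝ) :
    ExtendsAnalytically fun x => smoothMaxKernel κ (Real.arccos x) := by
  refine ⟨2, one_lt_two, fun z => Complex.exp (κ * (z - 1)), by fun_prop, fun x hx => ?_⟩
  simp [smoothMaxKernel, Real.cos_arccos hx.1 hx.2]

lemma exists_one_lt_forall_closedBall_re_pos {ρ : ℝ} (h0 : 0 < ρ) (h1 : ρ < 1) :
    ∃ R : ℝ, 1 < R ∧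
      ∀ z ∈ Metric.closedBall (0 : ℂ) R, 0 < (1 - 2 * ρ * z + ρ ^ 2 : ℂ).re := by
  have hone : 1 < (1 + ρ ^ 2) / (2 * ρ) := by
    rw [one_lt_div (by positivity)]
    nlinarith [sq_pos_of_pos (sub_pos.2 h1)]
  obtain ⟨R, hR, hR'⟩ := exists_between hone
  rw [lt_div_iff₀ (by positivity)] at hR'
  refine ⟨R, hR, fun z hz => ?_⟩
  have hzR : z.re ≤ R := (Complex.re_le_norm z).trans (mem_closedBall_zero_iff.1 hz)
  have hre : (1 - 2 * ρ * z + ρ ^ 2 : ℂ).re = 1 + ρ ^ 2 - 2 * ρ * z.re := by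
    have hcast : (1 - 2 * ρ * z + ρ ^ 2 : ℂ) = ((1 + ρ ^ 2 : ℝ) : ℂ) - ((2 * ρ : ℝ) : ℂ) * z := by
      push_cast
      ring
    rw [hcast, Complex.sub_re, Complex.re_ofReal_mul, Complex.ofReal_re]
  rw [hre]
  nlinarith

lemma extendsAnalytically_poissonKernel (q : ℕ) {ρ : ℝ} (h0 : 0 < ρ) (h1 : ρ < 1) :
    ExtendsAnalytically fun x => poissonKernel q ρ (Real.arccos x) := by
  obtain ⟨R, hR, hre⟩ := exists_one_lt_forall_closedBall_re_pos h0 h1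
  refine ⟨R, hR, fun z => (1 - ρ ^ 2) / (1 - 2 * ρ * z + ρ ^ 2) ^
    ((((q : ℝ) + 1) / 2 : ℝ) : ℂ), ?_, fun x hx => ?_⟩
  · refine DifferentiableOn.div (by fun_prop) ?_ fun z hz => ?_
    · exact DifferentiableOn.cpow (by fun_prop) (by fun_prop) fun z hz => Or.inl (hre z hz)
    · have hne : (1 - 2 * ρ * z + ρ ^ 2 : ℂ) ≠ 0 := fun hzero =>
        (hre z hz).ne' (by rw [hzero, Complex.zero_re])
      simp [Complex.cpow_eq_zero_iff, hne]
  · have hnonneg : 0 ≤ 1 - 2 * ρ * x + ρ ^ 2 := by nlinarith [hx.1, hx.2, sq_nonneg (1 - ρ)]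
    simp only [poissonKernel, Real.cos_arccos hx.1 hx.2]
    push_cast [Complex.ofReal_cpow hnonneg]
    rfl

lemma IsTestKernel.extendsAnalytically {q : ℕ} {ψ : ℝ → ℝ} (hψ : IsTestKernel q ψ) :
    ExtendsAnalytically fun x => ψ (Real.arccos x) := by
  rcases hψ with ⟨κ, -, rfl⟩ | ⟨ρ, h0, h1, rfl⟩
  · exact extendsAnalytically_smoothMaxKernel κ
  · exact extendsAnalytically_poissonKernel q h0 h1

lemma ExtendsAnalytically.exists_polynomial_abs_sub_le (hF : ExtendsAnalytically F) :
    ∃ a : ℝ, 0 < a ∧ a < 1 ∧ ∃ D : ℝ, 0 ≤ D ∧ ∀ n : ℕ, ∃ p : ℝ[X], p.degree < n ∧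
      ∀ x ∈ Set.Icc (-1 : ℝ) 1, |F x - p.eval x| ≤ D * a ^ n := by
  obtain ⟨R, hR, f, hf, hfF⟩ := hF
  lift R to NNReal using by linarith
  have hR0 : 0 < R := by exact_mod_cast zero_lt_one.trans hR
  obtain ⟨r, hr, hrR⟩ := exists_between (show (1 : NNReal) < R by exact_mod_cast hR)
  obtain ⟨a, ha, D, hD, happrox⟩ := (hf.hasFPowerSeriesOnBall hR0).uniform_geometric_approx
    (r' := r) (ENNReal.coe_lt_coe.2 hrR)
  set s := cauchyPowerSeries f 0 R
  refine ⟨a, ha.1, ha.2, D, hD.le, fun n =>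
    ⟨∑ k ∈ Finset.range n, C (s.coeff k).re * X ^ k, ?_, fun x hx => ?_⟩⟩
  · refine (degree_sum_le _ _).trans_lt
      ((Finset.sup_lt_iff (WithBot.bot_lt_coe n)).2 fun k hk => ?_)
    exact (degree_C_mul_X_pow_le _ _).trans_lt (WithBot.coe_lt_coe.2 (Finset.mem_range.1 hk))
  · have hxr : (x : ℂ) ∈ Metric.ball (0 : ℂ) r := by
      rw [mem_ball_zero_iff, Complex.norm_real, Real.norm_eq_abs]
      exact (abs_le.2 hx).trans_lt (by exact_mod_cast hr)
    have hre : F x - (∑ k ∈ Finset.range n, C (s.coeff k).re * X ^ k).eval x =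
        (f (0 + x) - s.partialSum n x).re := by
      simp only [zero_add, hfF x hx, FormalMultilinearSeries.partialSum, eval_finsetSum, eval_mul,
        eval_C, eval_pow, eval_X, FormalMultilinearSeries.apply_eq_pow_smul_coeff, smul_eq_mul,
        ← Complex.ofReal_pow, Complex.sub_re, Complex.ofReal_re, Complex.re_sum,
        Complex.re_ofReal_mul, mul_comm]
    rw [hre]
    exact (Complex.abs_re_le_norm _).trans (happrox x hxr n)

end AnalyticExtension

section Coefficients

variable {q : ℕ} [NeZero q]

lemma integral_basisPoly_mul (h : ℝ → ℝ) (k : ℕ) :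
    ∫ t, (basisPoly q k).eval t * h t ∂weightMeasure q = normConst q k * coeff q h k := by
  rw [coeff, ← integral_weightMeasure q fun x => h x * (basisPoly q k).eval x,
    mul_inv_cancel_left₀ (normConst_pos q k).ne']
  simp only [mul_comm]

lemma coeff_polynomial (p : ℝ[X]) (k : ℕ) :
    coeff q (fun t => p.eval t) k = weightIntegral q (p * basisPoly q k) / normConst q k := by
  rw [eq_div_iff (normConst_pos q k).ne', mul_comm, ← integral_basisPoly_mul, weightIntegral_apply]
  simp only [eval_mul, mul_comm]

lemma coeff_sub {F G : ℝ → ℝ} (hF : Integrable F (weightMeasure q))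
    (hG : Integrable G (weightMeasure q)) (k : ℕ) :
    coeff q (fun t => F t - G t) k = coeff q F k - coeff q G k := by
  refine mul_left_cancel₀ (normConst_pos q k).ne' ?_
  simp only [mul_sub, ← integral_basisPoly_mul]
  exact integral_sub (integrable_basisPoly_mul hF k) (integrable_basisPoly_mul hG k)

lemma abs_coeff_le {g : ℝ → ℝ} (hg : Integrable g (weightMeasure q)) (k : ℕ) :
    |coeff q g k| ≤ (basisPoly q k).eval 1 / normConst q k * ∫ t, |g t| ∂weightMeasure q := by
  have hc := normConst_pos q k
  rw [div_mul_eq_mul_div, le_div_iff₀ hc, mul_comm, ← abs_of_pos hc, ← abs_mul,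
    ← integral_basisPoly_mul]
  exact abs_integral_basisPoly_mul_le hg k

variable {F : ℝ → ℝ} {p : ℝ[X]} {ε : ℝ}

lemma abs_coeff_sub_coeff_polynomial_le (hF : ContinuousOn F (Set.Icc (-1) 1))
    (hp : ∀ x ∈ Set.Icc (-1 : ℝ) 1, |F x - p.eval x| ≤ ε) (k : ℕ) :
    |coeff q F k - coeff q (fun t => p.eval t) k| ≤
      (basisPoly q k).eval 1 / normConst q k * (ε * weightIntegral q 1) := by
  have hFint := integrable_weightMeasure_of_continuousOn q hF
  have hpint := integrable_weightMeasure_of_continuousOn q p.continuousOn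
  have hmean : ∫ t, |F t - p.eval t| ∂weightMeasure q ≤ ε * weightIntegral q 1 := by
    simp only [weightIntegral_apply, eval_one, ← integral_const_mul, mul_one]
    exact integral_mono_ae (hFint.sub hpint).abs (integrable_const ε)
      ((ae_mem_Icc_weightMeasure q).mono hp)
  rw [← coeff_sub hFint hpint]
  exact (abs_coeff_le (hFint.sub hpint) k).trans (mul_le_mul_of_nonneg_left hmean
    (div_pos (basisPoly_eval_one_pos q k) (normConst_pos q k)).le)

-- Lebesgue's inequality: the partial sums of the expansion reproduce `p`, so their error is at
-- most that of `p` times the norm of the projection.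
lemma abs_sub_sum_coeff_mul_basisPoly_le (hF : ContinuousOn F (Set.Icc (-1) 1)) {n : ℕ}
    (hdeg : p.degree < n) (hp : ∀ x ∈ Set.Icc (-1 : ℝ) 1, |F x - p.eval x| ≤ ε) {t : ℝ}
    (ht : t ∈ Set.Icc (-1 : ℝ) 1) :
    |F t - ∑ k ∈ Finset.range n, coeff q F k * (basisPoly q k).eval t| ≤
      ε * (1 + weightIntegral q 1 *
        ∑ k ∈ Finset.range n, (basisPoly q k).eval 1 / normConst q k * (basisPoly q k).eval 1) := by
  have hpt : p.eval t =
      ∑ k ∈ Finset.range n, coeff q (fun t => p.eval t) k * (basisPoly q k).eval t := by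
    have h := congrArg (eval t) (eq_sum_basisPoly q hdeg)
    simpa only [eval_finsetSum, eval_smul, smul_eq_mul, ← coeff_polynomial] using h
  have hsplit : F t - ∑ k ∈ Finset.range n, coeff q F k * (basisPoly q k).eval t =
      (F t - p.eval t) - ∑ k ∈ Finset.range n,
        (coeff q F k - coeff q (fun t => p.eval t) k) * (basisPoly q k).eval t := by
    rw [hpt]
    simp only [sub_mul, Finset.sum_sub_distrib]
    ring
  rw [hsplit, mul_one_add, Finset.mul_sum, Finset.mul_sum]
  refine (abs_sub _ _).trans (add_le_add (hp t ht) ((Finset.abs_sum_le_sum_abs _ _).trans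
    (Finset.sum_le_sum fun k _ => ?_)))
  rw [abs_mul]
  calc _ ≤ (basisPoly q k).eval 1 / normConst q k * (ε * weightIntegral q 1) *
        (basisPoly q k).eval 1 := by
        have hk := abs_coeff_sub_coeff_polynomial_le (q := q) hF hp k
        exact mul_le_mul hk (abs_basisPoly_eval_le k ht) (abs_nonneg _) ((abs_nonneg _).trans hk)
    _ = _ := by ring

lemma exists_sum_basisPoly_eval_one_sq_div_normConst_le (q : ℕ) [NeZero q] :
    ∃ A : ℝ, ∀ n : ℕ, ∑ k ∈ Finset.range n,
      (basisPoly q k).eval 1 / normConst q k * (basisPoly q k).eval 1 ≤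
        A * (n : ℝ) ^ (q + 2) := by
  obtain ⟨A, hA0, hA⟩ := exists_basisPoly_eval_one_div_normConst_le q
  refine ⟨A, fun n => ?_⟩
  have hterm : ∀ k ∈ Finset.range n,
      (basisPoly q k).eval 1 / normConst q k * (basisPoly q k).eval 1 ≤
        A * n * (n : ℝ) ^ q := by
    intro k hk
    have hkn : (k : ℝ) + 1 ≤ n := by exact_mod_cast Finset.mem_range.1 hk
    exact mul_le_mul ((hA k).trans (by gcongr)) ((basisPoly_eval_one_le q k).trans (by gcongr))
      (basisPoly_eval_one_pos q k).le (by positivity)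
  refine (Finset.sum_le_card_nsmul _ _ _ hterm).trans_eq ?_
  rw [Finset.card_range, nsmul_eq_mul]
  ring

end Coefficients

section AnalyticCoefficients

variable {q : ℕ} [NeZero q] {F : ℝ → ℝ}

lemma ExtendsAnalytically.exists_abs_coeff_le (hF : ExtendsAnalytically F) (q : ℕ) [NeZero q] :
    ∃ a : ℝ, 0 < a ∧ a < 1 ∧ ∃ D : ℝ, 0 ≤ D ∧
      ∀ k : ℕ, |coeff q F k| ≤ D * ((k : ℝ) + 1) * a ^ k := by
  obtain ⟨a, ha0, ha1, D, hD, happrox⟩ := hF.exists_polynomial_abs_sub_le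
  obtain ⟨A, hA0, hA⟩ := exists_basisPoly_eval_one_div_normConst_le q
  have hW := weightIntegral_one_pos q
  refine ⟨a, ha0, ha1, A * D * weightIntegral q 1, by positivity, fun k => ?_⟩
  obtain ⟨p, hdeg, hp⟩ := happrox k
  have hle := abs_coeff_sub_coeff_polynomial_le (q := q) hF.continuousOn hp k
  rw [coeff_polynomial, weightIntegral_mul_basisPoly_of_degree_lt q hdeg, zero_div,
    sub_zero] at hle
  calc |coeff q F k| ≤ A * ((k : ℝ) + 1) * (D * a ^ k * weightIntegral q 1) :=
        hle.trans (mul_le_mul_of_nonneg_right (hA k) (by positivity))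
    _ = _ := by ring

lemma summable_add_one_pow_mul_geometric (n : ℕ) {a : ℝ} (h0 : 0 < a) (h1 : a < 1) :
    Summable fun k : ℕ => ((k : ℝ) + 1) ^ n * a ^ k := by
  have hshift := (summable_nat_add_iff 1).2 (summable_pow_mul_geometric_of_norm_lt_one (R := ℝ) n
    (r := a) (by rwa [Real.norm_eq_abs, abs_of_pos h0]))
  refine (hshift.mul_left a⁻¹).congr fun k => ?_
  push_cast
  rw [pow_succ]
  field_simp

lemma ExtendsAnalytically.summable_abs_coeff_mul_basisPoly_eval_one (hF : ExtendsAnalytically F) :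
    Summable fun k => |coeff q F k| * (basisPoly q k).eval 1 := by
  obtain ⟨a, ha0, ha1, D, hD, hcoeff⟩ := hF.exists_abs_coeff_le q
  refine Summable.of_nonneg_of_le
    (fun k => mul_nonneg (abs_nonneg _) (basisPoly_eval_one_pos q k).le) (fun k => ?_)
    ((summable_add_one_pow_mul_geometric (q + 1) ha0 ha1).mul_left D)
  calc _ ≤ D * ((k : ℝ) + 1) * a ^ k * ((k : ℝ) + 1) ^ q :=
        mul_le_mul (hcoeff k) (basisPoly_eval_one_le q k) (basisPoly_eval_one_pos q k).le
          (by positivity)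
    _ = _ := by ring

lemma norm_coeff_mul_basisPoly_eval_le (F : ℝ → ℝ) (k : ℕ) {t : ℝ}
    (ht : t ∈ Set.Icc (-1 : ℝ) 1) :
    ‖coeff q F k * (basisPoly q k).eval t‖ ≤ |coeff q F k| * (basisPoly q k).eval 1 := by
  rw [norm_mul]
  exact mul_le_mul_of_nonneg_left (abs_basisPoly_eval_le k ht) (abs_nonneg _)

theorem ExtendsAnalytically.hasSum_coeff_mul_basisPoly (hF : ExtendsAnalytically F) {t : ℝ}
    (ht : t ∈ Set.Icc (-1 : ℝ) 1) :
    HasSum (fun k => coeff q F k * (basisPoly q k).eval t) (F t) := by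
  have hsummable : Summable fun k => ‖coeff q F k * (basisPoly q k).eval t‖ :=
    Summable.of_nonneg_of_le (fun _ => norm_nonneg _)
      (fun k => norm_coeff_mul_basisPoly_eval_le F k ht)
      hF.summable_abs_coeff_mul_basisPoly_eval_one
  rw [hasSum_iff_tendsto_nat_of_summable_norm hsummable, tendsto_iff_norm_sub_tendsto_zero]
  obtain ⟨a, ha0, ha1, D, hD, happrox⟩ := hF.exists_polynomial_abs_sub_le
  obtain ⟨A, hA⟩ := exists_sum_basisPoly_eval_one_sq_div_normConst_le q
  have hW := weightIntegral_one_pos q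
  have hlim : Filter.Tendsto
      (fun n : ℕ => D * a ^ n + D * weightIntegral q 1 * A * ((n : ℝ) ^ (q + 2) * a ^ n))
      Filter.atTop (nhds 0) := by
    have hgeom := (tendsto_pow_atTop_nhds_zero_of_lt_one ha0.le ha1).const_mul D
    have hpoly := (tendsto_pow_const_mul_const_pow_of_abs_lt_one (q + 2) (r := a)
      (by rwa [abs_of_pos ha0])).const_mul (D * weightIntegral q 1 * A)
    simpa using hgeom.add hpoly
  refine squeeze_zero (fun _ => norm_nonneg _) (fun n => ?_) hlim
  obtain ⟨p, hdeg, hp⟩ := happrox n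
  rw [norm_sub_rev, Real.norm_eq_abs]
  calc _ ≤ D * a ^ n * (1 + weightIntegral q 1 * (A * (n : ℝ) ^ (q + 2))) :=
        (abs_sub_sum_coeff_mul_basisPoly_le hF.continuousOn hdeg hp ht).trans (by
          gcongr
          exact hA n)
    _ = _ := by ring

end AnalyticCoefficients

section RotSymLaw

variable {q : ℕ} [NeZero q] {m : Sphere q} {g : ℝ → ℝ}

lemma integral_rotSymLaw (hg : AEStronglyMeasurable g (weightMeasure q))
    (hg0 : ∀ᵐ t ∂weightMeasure q, 0 ≤ g t) (φ : Sphere q → ℝ) :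
    ∫ x, φ x ∂rotSymLaw m g = ∫ x, φ x * g (dot m x) ∂surface q := by
  have hmeas : AEStronglyMeasurable (fun x => g (dot m x)) (surface q) :=
    (hg.smul_measure _).comp_measurePreserving (measurePreserving_dot m)
  simp only [rotSymLaw, dot_comm _ m]
  rw [integral_withDensity_eq_integral_toReal_smul₀ hmeas.aemeasurable.ennreal_ofReal
    (.of_forall fun _ => ENNReal.ofReal_lt_top)]
  refine integral_congr_ae ?_
  filter_upwards [ae_comp_dot m hg0] with x hx
  rw [ENNReal.toReal_ofReal hx, smul_eq_mul, mul_comm]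

lemma integrable_of_isProbabilityMeasure_rotSymLaw [IsProbabilityMeasure (rotSymLaw m g)]
    (hg : AEStronglyMeasurable g (weightMeasure q)) (hg0 : ∀ᵐ t ∂weightMeasure q, 0 ≤ g t) :
    Integrable g (weightMeasure q) := by
  have hmp := measurePreserving_dot m
  have hg' : AEStronglyMeasurable g (ENNReal.ofReal (area (q - 1)) • weightMeasure q) :=
    hg.smul_measure _
  have hint : Integrable (fun x => g (dot m x)) (surface q) := by
    refine ⟨hg'.comp_measurePreserving hmp, ?_⟩
    rw [hasFiniteIntegral_iff_ofReal (ae_comp_dot m hg0)]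
    simp only [dot_comm m]
    rw [← setLIntegral_univ, ← withDensity_apply _ MeasurableSet.univ]
    exact measure_lt_top (rotSymLaw m g) _
  have hsmul := (hmp.integrable_comp hg').1 hint
  rwa [integrable_smul_measure (by simpa using area_pos (q - 1)) ENNReal.ofReal_ne_top] at hsmul

lemma integral_basisPoly_dot_rotSymLaw (hg : Integrable g (weightMeasure q))
    (hg0 : ∀ᵐ t ∂weightMeasure q, 0 ≤ g t) (x : Sphere q) (k : ℕ) :
    ∫ y, (basisPoly q k).eval (dot x y) ∂rotSymLaw m g =
      heckeConst q k * coeff q g k * (basisPoly q k).eval (dot x m) := by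
  rw [integral_rotSymLaw hg.1 hg0, funk_hecke m hg, integral_basisPoly_mul, heckeConst]
  ring

lemma integral_zonal_rotSymLaw (hg : AEStronglyMeasurable g (weightMeasure q))
    (hg0 : ∀ᵐ t ∂weightMeasure q, 0 ≤ g t) {f : ℝ → ℝ}
    (hf : AEStronglyMeasurable f (weightMeasure q)) :
    ∫ x, f (dot x m) ∂rotSymLaw m g = area (q - 1) * ∫ t, f t * g t ∂weightMeasure q := by
  rw [integral_rotSymLaw hg hg0]
  simp only [dot_comm _ m]
  exact integral_comp_dot m (hf.mul hg)

-- The left-hand side is the mean of `P_k (m'y) / P_k 1` over the law of `y`.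
lemma abs_heckeConst_mul_coeff_le_one (m : Sphere q) [IsProbabilityMeasure (rotSymLaw m g)]
    (hg : Integrable g (weightMeasure q)) (hg0 : ∀ᵐ t ∂weightMeasure q, 0 ≤ g t) (k : ℕ) :
    |heckeConst q k * coeff q g k| ≤ 1 := by
  have hP := basisPoly_eval_one_pos q k
  have hmean : ‖∫ y, (basisPoly q k).eval (dot m y) ∂rotSymLaw m g‖ ≤ (basisPoly q k).eval 1 := by
    simpa using norm_integral_le_of_norm_le_const (μ := rotSymLaw m g)
      (f := fun y => (basisPoly q k).eval (dot m y))
      (.of_forall fun y => abs_basisPoly_eval_le k (dot_mem_Icc m y))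
  rw [integral_basisPoly_dot_rotSymLaw hg hg0, dot_self, Real.norm_eq_abs, abs_mul,
    abs_of_pos hP] at hmean
  exact (mul_le_iff_le_one_left hP).1 hmean

end RotSymLaw

section Projection

/-- The coefficients of the zonal function `x ↦ ∫ F(x'y) dν(y)`, the Hájek projection of the kernel
`F(x'y)` under the law `ν` with density `y ↦ g(y'μ)`, in the polynomials `P_{k,q}(x'μ)`. -/
def projectionCoeff (q : ℕ) (F g : ℝ → ℝ) (k : ℕ) : ℝ :=
  coeff q F k * (heckeConst q k * coeff q g k)

lemma hasSum_integral_of_norm_le_summable {α ι : Type*} [Countable ι] [MeasurableSpace α]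
    {μ : Measure α} [IsFiniteMeasure μ] {F : ι → α → ℝ} {f : α → ℝ} {b : ι → ℝ}
    (hF : ∀ i, AEStronglyMeasurable (F i) μ) (hb : ∀ i x, ‖F i x‖ ≤ b i) (hsum : Summable b)
    (hf : ∀ x, HasSum (fun i => F i x) (f x)) :
    HasSum (fun i => ∫ x, F i x ∂μ) (∫ x, f x ∂μ) :=
  hasSum_integral_of_dominated_convergence (fun i _ => b i) hF (fun i => .of_forall (hb i))
    (.of_forall fun _ => hsum) (integrable_const _) (.of_forall hf)

variable {q : ℕ} [NeZero q] {m : Sphere q} {g : ℝ → ℝ} [IsProbabilityMeasure (rotSymLaw m g)]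
  {F : ℝ → ℝ}

lemma abs_projectionCoeff_le (m : Sphere q) [IsProbabilityMeasure (rotSymLaw m g)] (F : ℝ → ℝ)
    (hg : Integrable g (weightMeasure q)) (hg0 : ∀ᵐ t ∂weightMeasure q, 0 ≤ g t) (k : ℕ) :
    |projectionCoeff q F g k| ≤ |coeff q F k| := by
  rw [projectionCoeff, abs_mul]
  exact mul_le_of_le_one_right (abs_nonneg _) (abs_heckeConst_mul_coeff_le_one m hg hg0 k)

lemma norm_projectionCoeff_mul_basisPoly_eval_le (F : ℝ → ℝ) (hg : Integrable g (weightMeasure q))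
    (hg0 : ∀ᵐ t ∂weightMeasure q, 0 ≤ g t) (k : ℕ) (x : Sphere q) :
    ‖projectionCoeff q F g k * (basisPoly q k).eval (dot x m)‖ ≤
      |coeff q F k| * (basisPoly q k).eval 1 := by
  rw [norm_mul]
  exact mul_le_mul (abs_projectionCoeff_le m F hg hg0 k)
    (abs_basisPoly_eval_le k (dot_mem_Icc x m)) (norm_nonneg _) (abs_nonneg _)

lemma ExtendsAnalytically.hasSum_projection (hF : ExtendsAnalytically F)
    (hg : Integrable g (weightMeasure q)) (hg0 : ∀ᵐ t ∂weightMeasure q, 0 ≤ g t) (x : Sphere q) :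
    HasSum (fun k => projectionCoeff q F g k * (basisPoly q k).eval (dot x m))
      (∫ y, F (dot x y) ∂rotSymLaw m g) := by
  have h := hasSum_integral_of_norm_le_summable (μ := rotSymLaw m g)
    (F := fun k y => coeff q F k * (basisPoly q k).eval (dot x y))
    (fun k => Continuous.aestronglyMeasurable (by fun_prop))
    (fun k y => norm_coeff_mul_basisPoly_eval_le F k (dot_mem_Icc x y))
    hF.summable_abs_coeff_mul_basisPoly_eval_one
    (fun y => hF.hasSum_coeff_mul_basisPoly (dot_mem_Icc x y))
  simpa only [integral_const_mul, integral_basisPoly_dot_rotSymLaw hg hg0, projectionCoeff,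
    mul_assoc] using h

lemma ExtendsAnalytically.hasSum_integral_projection (hF : ExtendsAnalytically F)
    (hg : Integrable g (weightMeasure q)) (hg0 : ∀ᵐ t ∂weightMeasure q, 0 ≤ g t) :
    HasSum (fun k => area q ^ 2 * (tau q k * coeff q F k * coeff q g k ^ 2))
      (∫ x, ∫ y, F (dot x y) ∂rotSymLaw m g ∂rotSymLaw m g) := by
  have h := hasSum_integral_of_norm_le_summable (μ := rotSymLaw m g)
    (F := fun k x => projectionCoeff q F g k * (basisPoly q k).eval (dot x m))
    (fun k => Continuous.aestronglyMeasurable (by fun_prop))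
    (norm_projectionCoeff_mul_basisPoly_eval_le F hg hg0)
    hF.summable_abs_coeff_mul_basisPoly_eval_one (hF.hasSum_projection hg hg0)
  refine h.congr_fun fun k => ?_
  rw [integral_const_mul,
    integral_zonal_rotSymLaw hg.1 hg0 (basisPoly q k).continuous.aestronglyMeasurable,
    integral_basisPoly_mul, projectionCoeff]
  linear_combination (coeff q F k * coeff q g k ^ 2) * area_sq_mul_tau q k

lemma ExtendsAnalytically.hasSum_projection_sq (hF : ExtendsAnalytically F)
    (hg : Integrable g (weightMeasure q)) (hg0 : ∀ᵐ t ∂weightMeasure q, 0 ≤ g t) (x : Sphere q) :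
    HasSum (fun k : ℕ × ℕ => projectionCoeff q F g k.1 * projectionCoeff q F g k.2 *
        ((basisPoly q k.1).eval (dot x m) * (basisPoly q k.2).eval (dot x m)))
      ((∫ y, F (dot x y) ∂rotSymLaw m g) ^ 2) := by
  have hnorm := Summable.of_nonneg_of_le (fun _ => norm_nonneg _)
    (fun k => norm_projectionCoeff_mul_basisPoly_eval_le (m := m) F hg hg0 k x)
    hF.summable_abs_coeff_mul_basisPoly_eval_one
  have h := hF.hasSum_projection (m := m) hg hg0 x
  rw [pow_two]
  exact (h.mul h (summable_mul_of_summable_norm hnorm hnorm)).congr_fun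
    fun k => mul_mul_mul_comm _ _ _ _

lemma ExtendsAnalytically.hasSum_integral_projection_sq (hF : ExtendsAnalytically F)
    (hg : Integrable g (weightMeasure q)) (hg0 : ∀ᵐ t ∂weightMeasure q, 0 ≤ g t) :
    HasSum (fun k : ℕ × ℕ => projectionCoeff q F g k.1 * projectionCoeff q F g k.2 *
        (area (q - 1) *
          ∫ t, (basisPoly q k.1).eval t * (basisPoly q k.2).eval t * g t ∂weightMeasure q))
      (∫ x, (∫ y, F (dot x y) ∂rotSymLaw m g) ^ 2 ∂rotSymLaw m g) := by
  set b : ℕ → ℝ := fun k => |coeff q F k| * (basisPoly q k).eval 1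
  have hbound := norm_projectionCoeff_mul_basisPoly_eval_le (m := m) F hg hg0
  have hb0 : ∀ k, 0 ≤ b k := fun k => (norm_nonneg _).trans (hbound k m)
  have hb : Summable b := hF.summable_abs_coeff_mul_basisPoly_eval_one
  have h := hasSum_integral_of_norm_le_summable (μ := rotSymLaw m g)
    (F := fun (k : ℕ × ℕ) x => projectionCoeff q F g k.1 * projectionCoeff q F g k.2 *
      ((basisPoly q k.1).eval (dot x m) * (basisPoly q k.2).eval (dot x m)))
    (b := fun k => b k.1 * b k.2) (fun k => Continuous.aestronglyMeasurable (by fun_prop))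
    (fun k x => by
      rw [mul_mul_mul_comm, norm_mul]
      exact mul_le_mul (hbound _ x) (hbound _ x) (norm_nonneg _) (hb0 _))
    (hb.mul_of_nonneg hb hb0 hb0) (hF.hasSum_projection_sq hg hg0)
  refine h.congr_fun fun k => ?_
  have hmeas : AEStronglyMeasurable
      (fun t => (basisPoly q k.1).eval t * (basisPoly q k.2).eval t) (weightMeasure q) :=
    Continuous.aestronglyMeasurable (by fun_prop)
  rw [← integral_zonal_rotSymLaw (m := m) hg.1 hg0 hmeas, integral_const_mul]

end Projection

section TripleSeries

variable {q : ℕ} [NeZero q] {g : ℝ → ℝ}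

lemma degree_basisPoly_mul_basisPoly (q : ℕ) [NeZero q] (k₁ k₂ : ℕ) :
    (basisPoly q k₁ * basisPoly q k₂).degree = ((k₁ + k₂ : ℕ) : WithBot ℕ) := by
  rw [degree_mul, degree_basisPoly, degree_basisPoly, Nat.cast_add]

lemma triple_eq_zero_of_lt (q : ℕ) [NeZero q] {k₁ k₂ k₃ : ℕ} (h : k₁ + k₂ < k₃) :
    triple q k₁ k₂ k₃ = 0 := by
  rw [triple_eq_weightIntegral]
  refine weightIntegral_mul_basisPoly_of_degree_lt q ?_
  rw [degree_basisPoly_mul_basisPoly]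
  exact WithBot.coe_lt_coe.2 h

lemma hasSum_coeff_mul_triple (hg : Integrable g (weightMeasure q)) (k₁ k₂ : ℕ) :
    HasSum (fun k₃ => coeff q g k₃ * triple q k₁ k₂ k₃)
      (∫ t, (basisPoly q k₁).eval t * (basisPoly q k₂).eval t * g t ∂weightMeasure q) := by
  have hdeg : (basisPoly q k₁ * basisPoly q k₂).degree < ((k₁ + k₂ + 1 : ℕ) : WithBot ℕ) := by
    rw [degree_basisPoly_mul_basisPoly]
    exact WithBot.coe_lt_coe.2 (Nat.lt_succ_self _)
  have hexpand : ∀ t, (basisPoly q k₁).eval t * (basisPoly q k₂).eval t * g t =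
      ∑ j ∈ Finset.range (k₁ + k₂ + 1),
        triple q k₁ k₂ j / normConst q j * ((basisPoly q j).eval t * g t) := fun t => by
    have h := congrArg (eval t) (eq_sum_basisPoly q hdeg)
    simp only [eval_mul, eval_finsetSum, eval_smul, smul_eq_mul, ← triple_eq_weightIntegral] at h
    simp only [h, Finset.sum_mul, mul_assoc]
  have hsum : ∫ t, (basisPoly q k₁).eval t * (basisPoly q k₂).eval t * g t ∂weightMeasure q =
      ∑ j ∈ Finset.range (k₁ + k₂ + 1), coeff q g j * triple q k₁ k₂ j := by
    simp only [hexpand]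
    rw [integral_finsetSum _ fun j _ => (integrable_basisPoly_mul hg j).const_mul _]
    refine Finset.sum_congr rfl fun j _ => ?_
    rw [integral_const_mul, integral_basisPoly_mul, ← mul_assoc,
      div_mul_cancel₀ _ (normConst_pos q j).ne', mul_comm]
  rw [hsum]
  refine hasSum_sum_of_ne_finset_zero fun j hj => ?_
  rw [triple_eq_zero_of_lt q (by simpa using hj), mul_zero]

lemma abs_triple_le (q : ℕ) [NeZero q] (k₁ k₂ k₃ : ℕ) :
    |triple q k₁ k₂ k₃| ≤ (basisPoly q k₁).eval 1 * (basisPoly q k₂).eval 1 *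
      (basisPoly q k₃).eval 1 * weightIntegral q 1 := by
  have hmass : (weightMeasure q).real Set.univ = weightIntegral q 1 := by
    simp [weightIntegral_apply]
  rw [triple_eq_weightIntegral, weightIntegral_apply, ← hmass, ← Real.norm_eq_abs]
  refine norm_integral_le_of_norm_le_const ?_
  filter_upwards [ae_mem_Icc_weightMeasure q] with t ht
  have hP := fun k => abs_basisPoly_eval_le (q := q) k ht
  have hP0 := fun k => (basisPoly_eval_one_pos q k).le
  rw [eval_mul, eval_mul, norm_mul, norm_mul]
  exact mul_le_mul (mul_le_mul (hP k₁) (hP k₂) (norm_nonneg _) (hP0 k₁)) (hP k₃) (norm_nonneg _)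
    (mul_nonneg (hP0 k₁) (hP0 k₂))

lemma exists_abs_coeff_mul_triple_le (hg : Integrable g (weightMeasure q)) :
    ∃ A : ℝ, ∀ k₁ k₂ k₃ : ℕ, |coeff q g k₃ * triple q k₁ k₂ k₃| ≤
      A * (((k₁ : ℝ) + 1) ^ q * ((k₂ : ℝ) + 1) ^ q * ((k₃ : ℝ) + 1) ^ (q + 1)) := by
  obtain ⟨A, hA0, hA⟩ := exists_basisPoly_eval_one_div_normConst_le q
  have hW := (weightIntegral_one_pos q).le
  refine ⟨A * (∫ t, |g t| ∂weightMeasure q) * weightIntegral q 1, fun k₁ k₂ k₃ => ?_⟩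
  have hG : 0 ≤ ∫ t, |g t| ∂weightMeasure q := integral_nonneg fun _ => abs_nonneg _
  have hcoeff : |coeff q g k₃| ≤ A * ((k₃ : ℝ) + 1) * ∫ t, |g t| ∂weightMeasure q :=
    (abs_coeff_le hg k₃).trans (mul_le_mul_of_nonneg_right (hA k₃) hG)
  have hP := basisPoly_eval_one_le q
  have hP0 := fun k => (basisPoly_eval_one_pos q k).le
  have htriple : |triple q k₁ k₂ k₃| ≤
      ((k₁ : ℝ) + 1) ^ q * ((k₂ : ℝ) + 1) ^ q * ((k₃ : ℝ) + 1) ^ q * weightIntegral q 1 := by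
    refine (abs_triple_le q k₁ k₂ k₃).trans ?_
    gcongr <;> apply_rules
  rw [abs_mul]
  calc _ ≤ (A * ((k₃ : ℝ) + 1) * ∫ t, |g t| ∂weightMeasure q) *
        (((k₁ : ℝ) + 1) ^ q * ((k₂ : ℝ) + 1) ^ q * ((k₃ : ℝ) + 1) ^ q * weightIntegral q 1) :=
        mul_le_mul hcoeff htriple (abs_nonneg _) (by positivity)
    _ = _ := by ring

-- Only the terms with `k₃ ≤ k₁ + k₂` survive, and for those `a ^ (k₁ + k₂)` is at most
-- `√a ^ (k₁ + k₂ + k₃)`: geometric decay in the first two indices yields decay in all three.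
lemma summable_mul_mul_coeff_mul_triple {c : ℕ → ℝ} {a D : ℝ} (ha0 : 0 < a) (ha1 : a < 1)
    (hc : ∀ k : ℕ, |c k| ≤ D * ((k : ℝ) + 1) * a ^ k) (hg : Integrable g (weightMeasure q)) :
    Summable fun k : ℕ × ℕ × ℕ =>
      c k.1 * c k.2.1 * (coeff q g k.2.2 * triple q k.1 k.2.1 k.2.2) := by
  obtain ⟨A, hA⟩ := exists_abs_coeff_mul_triple_le hg
  have hA0 : 0 ≤ A := by simpa using (abs_nonneg _).trans (hA 0 0 0)
  have hD0 : 0 ≤ D := by simpa using (abs_nonneg _).trans (hc 0)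
  have hs0 : 0 < √a := Real.sqrt_pos.2 ha0
  have hs1 : √a < 1 := (Real.sqrt_lt' one_pos).2 (by rwa [one_pow])
  set u : ℕ → ℝ := fun k => ((k : ℝ) + 1) ^ (q + 1) * √a ^ k with hu
  have hu0 : ∀ k, 0 ≤ u k := fun k => by positivity
  have hsummable : Summable u := summable_add_one_pow_mul_geometric (q + 1) hs0 hs1
  have hprod : Summable fun k : ℕ × ℕ × ℕ => u k.1 * (u k.2.1 * u k.2.2) :=
    hsummable.mul_of_nonneg (hsummable.mul_of_nonneg hsummable hu0 hu0) hu0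
      fun k => mul_nonneg (hu0 _) (hu0 _)
  refine Summable.of_norm_bounded (hprod.mul_left (D * D * A)) ?_
  rintro ⟨k₁, k₂, k₃⟩
  have hnonneg : 0 ≤ D * D * A * (u k₁ * (u k₂ * u k₃)) :=
    mul_nonneg (by positivity) (mul_nonneg (hu0 _) (mul_nonneg (hu0 _) (hu0 _)))
  rcases lt_or_ge (k₁ + k₂) k₃ with hlt | hle
  · simpa only [triple_eq_zero_of_lt q hlt, mul_zero, norm_zero] using hnonneg
  have hpow : a ^ k₁ * a ^ k₂ ≤ √a ^ k₁ * √a ^ k₂ * √a ^ k₃ := by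
    rw [← pow_add, ← pow_add, ← Real.mul_self_sqrt ha0.le, mul_pow,
      Real.sqrt_mul_self (Real.sqrt_nonneg a)]
    exact mul_le_mul_of_nonneg_left (pow_le_pow_of_le_one hs0.le hs1.le hle) (by positivity)
  rw [norm_mul, norm_mul]
  calc _ ≤ D * ((k₁ : ℝ) + 1) * a ^ k₁ * (D * ((k₂ : ℝ) + 1) * a ^ k₂) *
        (A * (((k₁ : ℝ) + 1) ^ q * ((k₂ : ℝ) + 1) ^ q * ((k₃ : ℝ) + 1) ^ (q + 1))) :=
        mul_le_mul (mul_le_mul (hc k₁) (hc k₂) (abs_nonneg _) (by positivity)) (hA k₁ k₂ k₃)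
          (abs_nonneg _) (by positivity)
    _ = D * D * A * (((k₁ : ℝ) + 1) ^ (q + 1) * ((k₂ : ℝ) + 1) ^ (q + 1) *
          ((k₃ : ℝ) + 1) ^ (q + 1)) * (a ^ k₁ * a ^ k₂) := by ring
    _ ≤ D * D * A * (((k₁ : ℝ) + 1) ^ (q + 1) * ((k₂ : ℝ) + 1) ^ (q + 1) *
          ((k₃ : ℝ) + 1) ^ (q + 1)) * (√a ^ k₁ * √a ^ k₂ * √a ^ k₃) := by gcongr
    _ = _ := by
        simp only [hu]
        ring

end TripleSeries

section VarianceSeries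

variable {q : ℕ} [NeZero q] {m : Sphere q} {g ψ : ℝ → ℝ} [IsProbabilityMeasure (rotSymLaw m g)]

lemma area_sq_mul_alphaOneTerm (q : ℕ) [NeZero q] (ψ g : ℝ → ℝ) (k : ℕ × ℕ × ℕ) :
    area q ^ 2 * alphaOneTerm q ψ g k =
      area (q - 1) * (projectionCoeff q (fun x => ψ (Real.arccos x)) g k.1 *
        projectionCoeff q (fun x => ψ (Real.arccos x)) g k.2.1 *
          (coeff q g k.2.2 * triple q k.1 k.2.1 k.2.2)) := by
  simp only [alphaOneTerm, projectionCoeff, kernelCoeff]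
  linear_combination (coeff q (fun x => ψ (Real.arccos x)) k.1 *
    coeff q (fun x => ψ (Real.arccos x)) k.2.1 * coeff q g k.1 * coeff q g k.2.1 *
      coeff q g k.2.2 * triple q k.1 k.2.1 k.2.2) * area_sq_mul_zeta q k.1 k.2.1

lemma summable_alphaOneTerm (hψ : ExtendsAnalytically fun x => ψ (Real.arccos x))
    (hg : Integrable g (weightMeasure q)) (hg0 : ∀ᵐ t ∂weightMeasure q, 0 ≤ g t)
    (m : Sphere q) [IsProbabilityMeasure (rotSymLaw m g)] :
    Summable (alphaOneTerm q ψ g) := by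
  obtain ⟨a, ha0, ha1, D, -, hcoeff⟩ := hψ.exists_abs_coeff_le q
  have h := summable_mul_mul_coeff_mul_triple ha0 ha1
    (fun k => (abs_projectionCoeff_le m _ hg hg0 k).trans (hcoeff k)) hg
  refine (summable_mul_left_iff (pow_pos (area_pos q) 2).ne').1 ?_
  simpa only [area_sq_mul_alphaOneTerm] using h.mul_left (area (q - 1))

theorem alphaOne_eq_integral (hψ : ExtendsAnalytically fun x => ψ (Real.arccos x))
    (hg : Integrable g (weightMeasure q)) (hg0 : ∀ᵐ t ∂weightMeasure q, 0 ≤ g t) :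
    alphaOne q ψ g = ∫ x, (∫ y, ψ (angle x y) ∂rotSymLaw m g) ^ 2 ∂rotSymLaw m g := by
  have htriple : HasSum (fun k => area q ^ 2 * alphaOneTerm q ψ g k) (alphaOne q ψ g) :=
    (summable_alphaOneTerm hψ hg hg0 m).hasSum.mul_left _
  simp only [area_sq_mul_alphaOneTerm] at htriple
  refine (((Equiv.prodAssoc ℕ ℕ ℕ).hasSum_iff.2 htriple).prod_fiberwise fun k => ?_).unique
    (hψ.hasSum_integral_projection_sq hg hg0)
  rw [mul_left_comm]
  exact ((hasSum_coeff_mul_triple hg k.1 k.2).mul_left _).mul_left _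

lemma hasSum_betaTerm (hψ : ExtendsAnalytically fun x => ψ (Real.arccos x))
    (hg : Integrable g (weightMeasure q)) (hg0 : ∀ᵐ t ∂weightMeasure q, 0 ≤ g t) :
    HasSum (fun k => area q ^ 2 * betaTerm q ψ g k)
      (∫ x, ∫ y, ψ (angle x y) ∂rotSymLaw m g ∂rotSymLaw m g) :=
  hψ.hasSum_integral_projection hg hg0

lemma summable_betaTerm (hψ : ExtendsAnalytically fun x => ψ (Real.arccos x))
    (hg : Integrable g (weightMeasure q)) (hg0 : ∀ᵐ t ∂weightMeasure q, 0 ≤ g t)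
    (m : Sphere q) [IsProbabilityMeasure (rotSymLaw m g)] :
    Summable (betaTerm q ψ g) :=
  (summable_mul_left_iff (pow_pos (area_pos q) 2).ne').1
    (hasSum_betaTerm (m := m) hψ hg hg0).summable

theorem betaConst_eq_integral (hψ : ExtendsAnalytically fun x => ψ (Real.arccos x))
    (hg : Integrable g (weightMeasure q)) (hg0 : ∀ᵐ t ∂weightMeasure q, 0 ≤ g t) :
    betaConst q ψ g = ∫ x, ∫ y, ψ (angle x y) ∂rotSymLaw m g ∂rotSymLaw m g := by
  rw [← (hasSum_betaTerm (m := m) hψ hg hg0).tsum_eq, tsum_mul_left, betaConst]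

theorem alphaTwo_eq_integral (hψ : ExtendsAnalytically fun x => ψ (Real.arccos x))
    (hg : Integrable g (weightMeasure q)) (hg0 : ∀ᵐ t ∂weightMeasure q, 0 ≤ g t) :
    alphaTwo q ψ g = ∫ x, ∫ y, ψ (angle x y) ^ 2 ∂rotSymLaw m g ∂rotSymLaw m g :=
  betaConst_eq_integral (ψ := fun θ => ψ θ ^ 2) hψ.sq hg hg0

end VarianceSeries

section UStatistic

variable {Ω S ι : Type*} [MeasurableSpace Ω] [MeasurableSpace S] {P : Measure Ω} {μ : Measure S}
  {X : ι → Ω → S} {h : S → S → ℝ}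

lemma measurePreserving_prodMk_of_indepFun {T : Type*} [MeasurableSpace T] {ν : Measure T}
    [IsFiniteMeasure P] {f : Ω → S} {g : Ω → T} (hfg : IndepFun f g P)
    (hf : MeasurePreserving f P μ) (hg : MeasurePreserving g P ν) :
    MeasurePreserving (fun ω => (f ω, g ω)) P (μ.prod ν) := by
  refine ⟨hf.measurable.prodMk hg.measurable, ?_⟩
  rw [(indepFun_iff_map_prod_eq_prod_map_map hf.aemeasurable hg.aemeasurable).1 hfg, hf.map_eq,
    hg.map_eq]

lemma measurePreserving_pair (hXi : iIndepFun X P) (hX : ∀ i, MeasurePreserving (X i) P μ)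
    {i j : ι} (hij : i ≠ j) : MeasurePreserving (fun ω => (X i ω, X j ω)) P (μ.prod μ) :=
  have := hXi.isProbabilityMeasure
  measurePreserving_prodMk_of_indepFun (hXi.indepFun hij) (hX i) (hX j)

lemma measurePreserving_triple (hXi : iIndepFun X P) (hX : ∀ i, MeasurePreserving (X i) P μ)
    {i j k : ι} (hij : i ≠ j) (hik : i ≠ k) (hjk : j ≠ k) :
    MeasurePreserving (fun ω => (X i ω, X j ω, X k ω)) P (μ.prod (μ.prod μ)) :=
  have := hXi.isProbabilityMeasure
  measurePreserving_prodMk_of_indepFun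
    (hXi.indepFun_prodMk (fun i => (hX i).measurable) j k i hij.symm hik.symm).symm (hX i)
    (measurePreserving_pair hXi hX hjk)

variable (hh : MemLp (Function.uncurry h) 2 (μ.prod μ))

include hh

lemma memLp_pair (hXi : iIndepFun X P) (hX : ∀ i, MeasurePreserving (X i) P μ) {i j : ι}
    (hij : i ≠ j) : MemLp (fun ω => h (X i ω) (X j ω)) 2 P :=
  hh.comp_measurePreserving (measurePreserving_pair hXi hX hij)

lemma variance_pair (hXi : iIndepFun X P) (hX : ∀ i, MeasurePreserving (X i) P μ) {i j : ι}
    (hij : i ≠ j) :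
    Var[fun ω => h (X i ω) (X j ω); P] = Var[Function.uncurry h; μ.prod μ] :=
  have hp := measurePreserving_pair hXi hX hij
  (hp.variance_fun_comp hh.aemeasurable).trans rfl

variable [IsProbabilityMeasure μ]

lemma integral_pair (hXi : iIndepFun X P) (hX : ∀ i, MeasurePreserving (X i) P μ) {i j : ι}
    (hij : i ≠ j) : ∫ ω, h (X i ω) (X j ω) ∂P = ∫ x, ∫ y, h x y ∂μ ∂μ := by
  have hp := measurePreserving_pair hXi hX hij
  calc _ = ∫ p, Function.uncurry h p ∂μ.prod μ := by
        rw [← hp.map_eq, integral_map hp.aemeasurable (hp.map_eq ▸ hh.aestronglyMeasurable)]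
        rfl
    _ = ∫ x, ∫ y, h x y ∂μ ∂μ := integral_prod _ (hh.integrable one_le_two)

lemma integrable_mul_of_common :
    Integrable (fun p : S × S × S => h p.1 p.2.1 * h p.1 p.2.2) (μ.prod (μ.prod μ)) := by
  have h₁ : MeasurePreserving (fun p : S × S × S => (p.1, p.2.1)) (μ.prod (μ.prod μ))
      (μ.prod μ) := (MeasurePreserving.id μ).prod measurePreserving_fst
  have h₂ : MeasurePreserving (fun p : S × S × S => (p.1, p.2.2)) (μ.prod (μ.prod μ))
      (μ.prod μ) := (MeasurePreserving.id μ).prod measurePreserving_snd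
  exact (hh.comp_measurePreserving h₁).integrable_mul (hh.comp_measurePreserving h₂)

lemma memLp_integral : MemLp (fun x => ∫ y, h x y ∂μ) 2 μ := by
  refine (memLp_two_iff_integrable_sq
    (hh.integrable one_le_two).integral_prod_left.aestronglyMeasurable).2 ?_
  simpa only [Function.uncurry_apply_pair, integral_prod_mul, ← pow_two] using
    (integrable_mul_of_common hh).integral_prod_left

lemma integral_mul_of_common (hXi : iIndepFun X P) (hX : ∀ i, MeasurePreserving (X i) P μ)
    {i j k : ι} (hij : i ≠ j) (hik : i ≠ k) (hjk : j ≠ k) :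
    ∫ ω, h (X i ω) (X j ω) * h (X i ω) (X k ω) ∂P = ∫ x, (∫ y, h x y ∂μ) ^ 2 ∂μ := by
  have hp := measurePreserving_triple hXi hX hij hik hjk
  have hint := integrable_mul_of_common hh
  calc _ = ∫ p : S × S × S, h p.1 p.2.1 * h p.1 p.2.2 ∂μ.prod (μ.prod μ) := by
        rw [← hp.map_eq, integral_map hp.aemeasurable (hp.map_eq ▸ hint.aestronglyMeasurable)]
    _ = ∫ x, (∫ y, h x y ∂μ) ^ 2 ∂μ := by
        simp only [integral_prod _ hint, integral_prod_mul, pow_two]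

lemma covariance_pair_of_common (hXi : iIndepFun X P) (hX : ∀ i, MeasurePreserving (X i) P μ)
    {i j k : ι} (hij : i ≠ j) (hik : i ≠ k) (hjk : j ≠ k) :
    cov[fun ω => h (X i ω) (X j ω), fun ω => h (X i ω) (X k ω); P] =
      Var[fun x => ∫ y, h x y ∂μ; μ] := by
  have := hXi.isProbabilityMeasure
  rw [covariance_eq_sub (memLp_pair hh hXi hX hij) (memLp_pair hh hXi hX hik),
    variance_eq_sub (memLp_integral hh), integral_pair hh hXi hX hij, integral_pair hh hXi hX hik,
    ← pow_two]
  exact congrArg (· - _) (integral_mul_of_common hh hXi hX hij hik hjk)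

omit [IsProbabilityMeasure μ] in
lemma covariance_pair_of_disjoint (hXi : iIndepFun X P) (hX : ∀ i, MeasurePreserving (X i) P μ)
    {i j k l : ι} (hij : i ≠ j) (hkl : k ≠ l) (hik : i ≠ k) (hil : i ≠ l) (hjk : j ≠ k)
    (hjl : j ≠ l) : cov[fun ω => h (X i ω) (X j ω), fun ω => h (X k ω) (X l ω); P] = 0 := by
  have := hXi.isProbabilityMeasure
  have hindep := hXi.indepFun_prodMk_prodMk (fun i => (hX i).measurable) i j k l hik hil hjk hjl
  have hm {a b : ι} (hab : a ≠ b) :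
      AEMeasurable (Function.uncurry h) (P.map fun ω => (X a ω, X b ω)) :=
    (measurePreserving_pair hXi hX hab).map_eq ▸ hh.aemeasurable
  exact (hindep.comp₀ (measurePreserving_pair hXi hX hij).aemeasurable
    (measurePreserving_pair hXi hX hkl).aemeasurable (hm hij) (hm hkl)).covariance_eq_zero
    (memLp_pair hh hXi hX hij) (memLp_pair hh hXi hX hkl)

/-- The covariance of `h(X_i, X_j)` and `h(X_k, X_l)` as a function of the pairs `p = (i, j)` and
`r = (k, l)` of distinct indices, for a symmetric kernel `h` and independent identically distributed
`X_i`: it is `η₁` if the pairs have exactly one common entry, `η₂` if they agree up to order, and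
`0` if they are disjoint. -/
def pairCovariance [DecidableEq ι] (η₁ η₂ : ℝ) (p r : ι × ι) : ℝ :=
  η₁ * ((if p.1 = r.1 then 1 else 0) + (if p.1 = r.2 then 1 else 0) +
      (if p.2 = r.1 then 1 else 0) + if p.2 = r.2 then 1 else 0) +
    (η₂ - 2 * η₁) * ((if p.1 = r.1 then 1 else 0) * (if p.2 = r.2 then 1 else 0) +
      (if p.1 = r.2 then 1 else 0) * if p.2 = r.1 then 1 else 0)

lemma covariance_pair [DecidableEq ι] (hs : ∀ x y, h x y = h y x) (hXi : iIndepFun X P)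
    (hX : ∀ i, MeasurePreserving (X i) P μ) {i j k l : ι} (hij : i ≠ j) (hkl : k ≠ l) :
    cov[fun ω => h (X i ω) (X j ω), fun ω => h (X k ω) (X l ω); P] =
      pairCovariance Var[fun x => ∫ y, h x y ∂μ; μ] Var[Function.uncurry h; μ.prod μ]
        (i, j) (k, l) := by
  have same {i j : ι} (hij : i ≠ j) := variance_pair hh hXi hX hij ▸
    covariance_self (memLp_pair hh hXi hX hij).aemeasurable
  have common {i j k : ι} := covariance_pair_of_common (i := i) (j := j) (k := k) hh hXi hX
  have swap (a b : ι) : (fun ω => h (X a ω) (X b ω)) = fun ω => h (X b ω) (X a ω) :=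
    funext fun ω => hs _ _
  unfold pairCovariance
  rcases eq_or_ne i k with rfl | hik
  · rcases eq_or_ne j l with rfl | hjl
    · rw [same hij]
      simp only [hij, hij.symm, if_true, if_false]
      ring
    · rw [common hij hkl hjl]
      simp [hij.symm, hkl, hjl]
  rcases eq_or_ne i l with rfl | hil
  · rw [swap k i]
    rcases eq_or_ne j k with rfl | hjk
    · rw [same hij]
      simp only [hij, hij.symm, if_true, if_false]
      ring
    · rw [common hij hik hjk]
      simp [hij.symm, hik, hjk]
  rcases eq_or_ne j k with rfl | hjk
  · rw [swap i j, common hij.symm hkl hil]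
    simp [hik, hil, hkl]
  rcases eq_or_ne j l with rfl | hjl
  · rw [swap i j, swap k j, common hij.symm hjk hik]
    simp [hik, hil, hjk]
  rw [covariance_pair_of_disjoint hh hXi hX hij hkl hik hil hjk hjl]
  simp [hik, hil, hjk, hjl]

omit hh [IsProbabilityMeasure μ]

lemma sum_offDiag {M : Type*} [Fintype ι] [AddCommGroup M] (f : ι × ι → M) :
    ∑ p ∈ Finset.univ.offDiag, f p = ∑ i, ∑ j, f (i, j) - ∑ i, f (i, i) := by
  classical
  rw [eq_sub_iff_add_eq, ← Finset.sum_product, add_comm, ← Finset.diag_union_offDiag,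
    Finset.sum_union (Finset.disjoint_diag_offDiag _), Finset.sum_diag]

lemma sum_offDiag_pairCovariance [Fintype ι] [DecidableEq ι] (η₁ η₂ : ℝ) {p : ι × ι}
    (hp : p.1 ≠ p.2) :
    ∑ r ∈ Finset.univ.offDiag, pairCovariance η₁ η₂ p r =
      4 * ((Fintype.card ι : ℝ) - 2) * η₁ + 2 * η₂ := by
  have hconst (a : ι) : ∑ i, ∑ _j : ι, (if a = i then (1 : ℝ) else 0) = Fintype.card ι := by
    simp
  simp only [sum_offDiag, pairCovariance, mul_ite, mul_one, mul_zero, Finset.sum_add_distrib,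
    ← Finset.mul_sum, Finset.sum_ite_eq, Finset.mem_univ, if_true, Finset.sum_const,
    Finset.card_univ, nsmul_eq_mul, hconst, hp, if_false, Finset.sum_ite_irrel]
  ring

lemma sum_offDiag_eq_two_mul_sum_Ioi {R : Type*} [NonAssocRing R] [Fintype ι] [LinearOrder ι]
    [LocallyFiniteOrderTop ι] [LocallyFiniteOrderBot ι] {f : ι → ι → R}
    (hf : ∀ i j, f i j = f j i) :
    ∑ p ∈ Finset.univ.offDiag, f p.1 p.2 = 2 * ∑ i, ∑ j ∈ Finset.Ioi i, f i j := by
  have h := Finset.sum_sum_Ioi_add_eq_sum_sum_off_diag fun i j => f j i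
  simp only [Finset.compl_singleton, Finset.sum_erase_eq_sub (Finset.mem_univ _),
    Finset.sum_sub_distrib] at h
  rw [sum_offDiag, ← h]
  simp only [hf _ _, ← two_mul, Finset.mul_sum]

include hh in
theorem variance_sum_offDiag [Fintype ι] [IsProbabilityMeasure μ] (hs : ∀ x y, h x y = h y x)
    (hXi : iIndepFun X P) (hX : ∀ i, MeasurePreserving (X i) P μ) :
    Var[fun ω => ∑ p ∈ Finset.univ.offDiag, h (X p.1 ω) (X p.2 ω); P] =
      Fintype.card ι * ((Fintype.card ι : ℝ) - 1) *
        (4 * ((Fintype.card ι : ℝ) - 2) * Var[fun x => ∫ y, h x y ∂μ; μ] +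
          2 * Var[Function.uncurry h; μ.prod μ]) := by
  classical
  have := hXi.isProbabilityMeasure
  have hne {p : ι × ι} (hp : p ∈ (Finset.univ : Finset ι).offDiag) : p.1 ≠ p.2 :=
    (Finset.mem_offDiag.1 hp).2.2
  rw [variance_fun_sum' fun p hp => memLp_pair hh hXi hX (hne hp),
    Finset.sum_congr rfl fun p hp => (Finset.sum_congr rfl fun r hr =>
      covariance_pair hh hs hXi hX (hne hp) (hne hr)).trans
      (sum_offDiag_pairCovariance _ _ (hne hp)),
    Finset.sum_const, Finset.offDiag_card, Finset.card_univ, nsmul_eq_mul,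
    Nat.cast_sub (Nat.le_mul_self _)]
  push_cast
  ring

end UStatistic

section Statistic

variable {q n : ℕ} {ψ : ℝ → ℝ} {Ω : Type*} [MeasurableSpace Ω] {P : Measure Ω}
  {μ : Measure (Sphere q)} {X : Fin n → Ω → Sphere q}

lemma memLp_kernel [IsFiniteMeasure μ]
    (hψ : ContinuousOn (fun x => ψ (Real.arccos x)) (Set.Icc (-1) 1)) :
    MemLp (Function.uncurry fun x y : Sphere q => ψ (angle x y)) 2 (μ.prod μ) := by
  obtain ⟨B, hB⟩ := isCompact_Icc.exists_bound_of_continuousOn hψ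
  exact .of_bound (hψ.comp_continuous continuous_dot fun p =>
    dot_mem_Icc p.1 p.2).aestronglyMeasurable B (.of_forall fun p => hB _ (dot_mem_Icc p.1 p.2))

variable [IsProbabilityMeasure μ]
  (hψ : ContinuousOn (fun x => ψ (Real.arccos x)) (Set.Icc (-1) 1))

include hψ

lemma memLp_statistic (hXi : iIndepFun X P) (hX : ∀ i, MeasurePreserving (X i) P μ) :
    MemLp (fun ω => statistic ψ fun i => X i ω) 2 P := by
  have := hXi.isProbabilityMeasure
  exact (memLp_finsetSum _ fun i _ => memLp_finsetSum _ fun j hj => (memLp_pair (memLp_kernel hψ)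
    hXi hX (Finset.mem_Ioi.1 hj).ne).sub (memLp_const _)).const_mul _

omit hψ in
lemma statistic_eq_sum_offDiag (ψ : ℝ → ℝ) (x : Fin n → Sphere q) :
    statistic ψ x = 1 / n * (∑ p ∈ Finset.univ.offDiag, ψ (angle (x p.1) (x p.2)) -
      n * (n - 1) * nullMean q ψ) := by
  have h := sum_offDiag_eq_two_mul_sum_Ioi (f := fun i j => ψ (angle (x i) (x j)) - nullMean q ψ)
    fun i j => by simp only [angle, dot_comm]
  rw [statistic, div_mul_eq_mul_div, ← h, Finset.sum_sub_distrib, Finset.sum_const,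
    Finset.offDiag_card, Finset.card_fin, nsmul_eq_mul, Nat.cast_sub (Nat.le_mul_self _)]
  push_cast
  ring

theorem variance_statistic (hn : n ≠ 0) (hXi : iIndepFun X P)
    (hX : ∀ i, MeasurePreserving (X i) P μ) :
    Var[fun ω => statistic ψ fun i => X i ω; P] =
      2 * ((n : ℝ) - 1) / n * (2 * ((n : ℝ) - 2) * Var[fun x => ∫ y, ψ (angle x y) ∂μ; μ] +
        Var[Function.uncurry fun x y => ψ (angle x y); μ.prod μ]) := by
  have := hXi.isProbabilityMeasure
  have hh := memLp_kernel (μ := μ) hψ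
  have hs (x y : Sphere q) : ψ (angle x y) = ψ (angle y x) := by
    simp only [angle, dot_comm]
  have hm : MemLp (fun ω => ∑ p ∈ Finset.univ.offDiag, ψ (angle (X p.1 ω) (X p.2 ω))) 2 P :=
    memLp_finsetSum _ fun p hp => memLp_pair hh hXi hX (Finset.mem_offDiag.1 hp).2.2
  simp only [statistic_eq_sum_offDiag]
  rw [variance_const_mul, variance_sub_const hm.aestronglyMeasurable,
    variance_sum_offDiag hh hs hXi hX, Fintype.card_fin]
  field_simp
  ring

end Statistic

section VarianceComponents

variable {q : ℕ} [NeZero q] {ψ g : ℝ → ℝ} {m : Sphere q} [IsProbabilityMeasure (rotSymLaw m g)]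

lemma etaOne_eq_variance (hψ : ExtendsAnalytically fun x => ψ (Real.arccos x))
    (hg : Integrable g (weightMeasure q)) (hg0 : ∀ᵐ t ∂weightMeasure q, 0 ≤ g t) :
    etaOne q ψ g = Var[fun x => ∫ y, ψ (angle x y) ∂rotSymLaw m g; rotSymLaw m g] := by
  rw [etaOne, variance_eq_sub (memLp_integral (memLp_kernel hψ.continuousOn)),
    alphaOne_eq_integral (m := m) hψ hg hg0, betaConst_eq_integral (m := m) hψ hg hg0]
  rfl

lemma etaTwo_eq_variance (hψ : ExtendsAnalytically fun x => ψ (Real.arccos x))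
    (hg : Integrable g (weightMeasure q)) (hg0 : ∀ᵐ t ∂weightMeasure q, 0 ≤ g t) :
    etaTwo q ψ g =
      Var[Function.uncurry fun x y => ψ (angle x y); (rotSymLaw m g).prod (rotSymLaw m g)] := by
  have hh := memLp_kernel (μ := rotSymLaw m g) hψ.continuousOn
  rw [etaTwo, variance_eq_sub hh, alphaTwo_eq_integral (m := m) hψ hg hg0,
    betaConst_eq_integral (m := m) hψ hg hg0, integral_prod _ (hh.integrable one_le_two)]
  exact congrArg (· - _) (integral_prod _ hh.integrable_sq).symm

end VarianceComponents

end SphereUniformity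

end

open SphereUniformity in
theorem proposition6_general (q : ℕ) [NeZero q] (n : ℕ) (hn : n ≠ 0)
    (ψ : ℝ → ℝ) (hψ : ExtendsAnalytically fun x => ψ (Real.arccos x)) (m : Sphere q) (g : ℝ → ℝ)
    (hg : AEStronglyMeasurable g (weightMeasure q)) (hg0 : ∀ᵐ t ∂weightMeasure q, 0 ≤ g t)
    {Ω : Type*} [MeasurableSpace Ω] (P : Measure Ω) (X : Fin n → Ω → Sphere q)
    (hXm : ∀ i, Measurable (X i)) (hXi : iIndepFun X P)
    (hXlaw : ∀ i, P.map (X i) = rotSymLaw m g) :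
    MemLp (fun ω => statistic ψ fun i => X i ω) 2 P ∧
    Summable (alphaOneTerm q ψ g) ∧
    Summable (betaTerm q (fun θ => ψ θ ^ 2) g) ∧
    Summable (betaTerm q ψ g) ∧
    Var[fun ω => statistic ψ fun i => X i ω; P] =
      2 * ((n : ℝ) - 1) / n * (2 * ((n : ℝ) - 2) * etaOne q ψ g + etaTwo q ψ g) ∧
    ∀ k₁ k₂ k₃ : ℕ, k₁ ≤ k₂ → k₂ ≤ k₃ →
      triple q k₁ k₂ k₃ =
        if q = 1 then
          if k₃ = k₂ + k₁ ∨ k₃ = k₂ - k₁ then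
            (1 + if k₁ = 0 then 1 else 0) / 2 * normConst 1 k₃ else 0
        else
          if Odd (k₁ + k₂ + k₃) ∨ k₁ + k₂ < k₃ then 0 else
            linCoeff ((k₁ + k₂ - k₃) / 2) k₁ k₂ (((q : ℝ) - 1) / 2) * normConst q k₃ := by
  have hX : ∀ i, MeasurePreserving (X i) P (rotSymLaw m g) := fun i => ⟨hXm i, hXlaw i⟩
  have : IsProbabilityMeasure (rotSymLaw m g) := by
    have := hXi.isProbabilityMeasure
    rw [← hXlaw ⟨0, hn.bot_lt⟩]
    exact Measure.isProbabilityMeasure_map (hXm _).aemeasurable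
  have hgi := integrable_of_isProbabilityMeasure_rotSymLaw (m := m) hg hg0
  refine ⟨memLp_statistic hψ.continuousOn hXi hX, summable_alphaOneTerm hψ hgi hg0 m,
    summable_betaTerm (ψ := fun θ => ψ θ ^ 2) hψ.sq hgi hg0 m, summable_betaTerm hψ hgi hg0 m, ?_,
    fun _ _ _ => triple_of_le q⟩
  rw [etaOne_eq_variance (m := m) hψ hgi hg0, etaTwo_eq_variance (m := m) hψ hgi hg0,
    variance_statistic hψ.continuousOn hn hXi hX]

theorem proposition6 (q : ℕ) (hq : 1 ≤ q) (n : ℕ) (hn : 1 ≤ n)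
    (ψ : ℝ → ℝ) (hψ : SphereUniformity.IsTestKernel q ψ)
    (m : SphereUniformity.Sphere q) (g : ℝ → ℝ)
    (hg : MemLp g 2 (SphereUniformity.weightMeasure q))
    (hg0 : ∀ᵐ t ∂(SphereUniformity.weightMeasure q), 0 ≤ g t)
    {Ω : Type*} [MeasurableSpace Ω] (P : Measure Ω) [IsProbabilityMeasure P]
    (X : Fin n → Ω → SphereUniformity.Sphere q)
    (hXm : ∀ i, Measurable (X i)) (hXi : iIndepFun X P)
    (hXlaw : ∀ i, P.map (X i) = SphereUniformity.rotSymLaw m g) :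
    -- the statistic has a finite second moment and the three series converge (absolutely)
    MemLp (fun ω => SphereUniformity.statistic ψ (fun i => X i ω)) 2 P ∧
    Summable (SphereUniformity.alphaOneTerm q ψ g) ∧
    Summable (SphereUniformity.betaTerm q (fun θ => ψ θ ^ 2) g) ∧
    Summable (SphereUniformity.betaTerm q ψ g) ∧
    -- the variance
    variance (fun ω => SphereUniformity.statistic ψ (fun i => X i ω)) P =
      2 * ((n : ℝ) - 1) / n *
        (2 * ((n : ℝ) - 2) * SphereUniformity.etaOne q ψ g + SphereUniformity.etaTwo q ψ g) ∧
    -- the values of the triple-product integrals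
    (∀ k₁ k₂ k₃ : ℕ, k₁ ≤ k₂ → k₂ ≤ k₃ →
      SphereUniformity.triple q k₁ k₂ k₃ =
        if q = 1 then
          (if k₃ = k₂ + k₁ ∨ k₃ = k₂ - k₁ then
            (1 + if k₁ = 0 then 1 else 0) / 2 * SphereUniformity.normConst 1 k₃ else 0)
        else
          (if Odd (k₁ + k₂ + k₃) ∨ k₁ + k₂ < k₃ then 0 else
            SphereUniformity.linCoeff ((k₁ + k₂ - k₃) / 2) k₁ k₂ (((q : ℝ) - 1) / 2) *
              SphereUniformity.normConst q k₃)) := by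
  have : NeZero q := ⟨Nat.one_le_iff_ne_zero.1 hq⟩
  exact proposition6_general q n (Nat.one_le_iff_ne_zero.1 hn) ψ hψ.extendsAnalytically m g hg.1 hg0
    P X hXm hXi hXlaw
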